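/- Let $P$ be a simple orthogonal polygon, i.e. a compact region that is the closure of its interior and whose boundary is a simple closed polygonal chain with axis-parallel edges and a right angle at every vertex. A sliding robot (sliding camera) moves along an axis-parallel line segment $s\subseteq P$ of positive length; standing at $q\in s$ it sees the points $p$ such that $\overline{pq}$ is perpendicular to $s$ (or $p=q$) and $\overline{pq}\subseteq P$. The set of these $p$ is its line of sight at $q$, and the union over $q\in s$ is the sliding visibility polygon of $s$. A set $S$ of segments in $P$ guards $P$ if the sliding visibility polygons of its members have union $P$. A group of robots moving continuously along their segments during a time interval $[0,T]$ clears $P$ if for every continuous curve $\gamma:[0,T]\to P$ (an evader of unbounded speed) there is a time $t$ at which some robot of the group sees $\gamma(t)$. Let $S$ be a finite set of segments that guards $P$, with one robot on each segment of $S$. Consider the following algorithm. It keeps a stack of called robots, each with a sub-polygon that it was asked to clear, a part of it that it still has to clear (initially all of it), and a direction of travel. The last called robot is active, the others wait. * *Start.* An arbitrary robot, at an endpoint of its segment, is called to clear $P$, travelling towards the other endpoint; the other robots are anywhere on their segments. * *Signal.* Let the active robot $r$, on the segment $s$ and with line of sight $\ell$, still have to clear $A$. If some connected component $W$ of $A\setminus\ell$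 is disjoint from the sliding visibility polygon of $s$, then $r$ waits, and a robot that is not on the stack and whose sliding visibility polygon meets $W$ is called to clear $W$: it chooses a direction and goes to a position of its segment before which (in that direction) it sees nothing of $W$. * *Advance.* If $A\setminus\ell\neq\emptyset$ and there is no such $W$, then $r$ moves in its direction to its next event point (the next position at which it sees a reflex vertex of $P$, or sees a waiting robot, or is at the endpoint of $s$), and everything that it sees on the way is removed from $A$. * *Move back and update, termination.* If $A\subseteq\ell$, then $r$ goes back along $s$ to some position that is not ahead of its current one (possibly the current one) and leaves the stack, and the sub-polygon that $r$ was asked to clear is removed from what the robot that called it still has to clear; that robot becomes active. If no robot is left on the stack, the algorithm terminates. Only one robot moves at a time, at unit speed. All choices left open above are arbitrary. **Corollary.** If $S$ has minimum cardinality among the finite sets of segments in $P$ that guard $P$, then, for every starting robot and every start configuration, the algorithm never gets stuck before it terminates, it has no infinite execution, and in every execution the robots that are called clear $P$; their number is the least $m$ such that $P$ can be cleared by $m$ sliding robots moving continuously along any $m$ segments in $P$. -/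

import Mathlib

open Set

namespace SlidingRobots

/-- A point of the plane. -/
abbrev Pt : Type := ℝ × ℝ

/-! ## Simple orthogonal polygons -/

/-- A simple orthogonal polygon: a compact region, equal to the closure of its interior, whose
boundary is a simple closed polygonal chain with axis-parallel edges and a right angle at every
vertex. The vertices are listed in cyclic order. -/
structure OrthogonalPolygon where
  n : ℕ
  four_le : 4 ≤ n
  vertex : ZMod n → Pt
  vertex_ne : ∀ j, vertex j ≠ vertex (j + 1)
  /-- consecutive edges are axis-parallel and perpendicular to each other -/
  orthogonal : ∀ j,
    ((vertex j).2 = (vertex (j + 1)).2 ∧ (vertex (j + 1)).1 = (vertex (j + 2)).1) ∨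
    ((vertex j).1 = (vertex (j + 1)).1 ∧ (vertex (j + 1)).2 = (vertex (j + 2)).2)
  /-- consecutive edges meet only in their common vertex -/
  adjacent : ∀ j, segment ℝ (vertex j) (vertex (j + 1)) ∩
    segment ℝ (vertex (j + 1)) (vertex (j + 2)) = {vertex (j + 1)}
  /-- edges that are not consecutive are disjoint -/
  simple : ∀ i j, i ≠ j → j ≠ i + 1 → i ≠ j + 1 →
    Disjoint (segment ℝ (vertex i) (vertex (i + 1))) (segment ℝ (vertex j) (vertex (j + 1)))
  region : Set Pt
  isCompact_region : IsCompact region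
  closure_interior : closure (interior region) = region
  frontier_region : frontier region = ⋃ j, segment ℝ (vertex j) (vertex (j + 1))

/-- The vertex with index `j` is reflex (its interior angle exceeds `π`): points close to it in the
quadrant spanned by its two edges are outside the polygon. -/
def OrthogonalPolygon.IsReflex (P : OrthogonalPolygon) (j : ZMod P.n) : Prop :=
  ∃ δ > (0 : ℝ), ∀ ε, 0 < ε → ε < δ →
    P.vertex j + ε • ((P.vertex (j - 1) - P.vertex j) + (P.vertex (j + 1) - P.vertex j))
      ∉ P.region

/-! ## Sliding cameras -/

/-- A nondegenerate axis-parallel line segment: `[lo, hi] × {level}` if `horizontal`, and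
`{level} × [lo, hi]` otherwise. -/
structure SlidingSegment where
  horizontal : Bool
  level : ℝ
  lo : ℝ
  hi : ℝ
  lo_lt_hi : lo < hi

namespace SlidingSegment

/-- The point of the line of `s` with parameter `u`. -/
def point (s : SlidingSegment) (u : ℝ) : Pt :=
  if s.horizontal then (u, s.level) else (s.level, u)

/-- The coordinate along the direction of `s`. -/
def along (s : SlidingSegment) (p : Pt) : ℝ :=
  if s.horizontal then p.1 else p.2

/-- The points of the segment. -/
def carrier (s : SlidingSegment) : Set Pt := s.point '' Icc s.lo s.hi

/-- The endpoint from which a traversal in the given direction starts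
(`true`: increasing parameter). -/
def first (s : SlidingSegment) : Bool → ℝ
  | true => s.lo
  | false => s.hi

/-- The endpoint at which a traversal in the given direction ends. -/
def last (s : SlidingSegment) : Bool → ℝ
  | true => s.hi
  | false => s.lo

end SlidingSegment

/-- What a robot at position `u` of `s` sees: the points `p` such that the segment from `p` to the
robot is perpendicular to `s` (or is one point) and is contained in the polygon. -/
def sight (P : OrthogonalPolygon) (s : SlidingSegment) (u : ℝ) : Set Pt :=
  {p | s.along p = u ∧ segment ℝ p (s.point u) ⊆ P.region}

/-- The sliding visibility polygon of `s`. -/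
def visibility (P : OrthogonalPolygon) (s : SlidingSegment) : Set Pt :=
  ⋃ u ∈ Icc s.lo s.hi, sight P s u

/-- `S` is a set of sliding cameras in `P` that guards `P`. -/
def IsGuardSet (P : OrthogonalPolygon) (S : Finset SlidingSegment) : Prop :=
  (∀ s ∈ S, s.carrier ⊆ P.region) ∧ (⋃ s ∈ S, visibility P s) = P.region

/-- `S` is a guarding set of sliding cameras of minimum cardinality. -/
def IsMinimumGuardSet (P : OrthogonalPolygon) (S : Finset SlidingSegment) : Prop :=
  IsGuardSet P S ∧ ∀ S' : Finset SlidingSegment, IsGuardSet P S' → S.card ≤ S'.card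

/-! ## Motions and evaders -/

section Motion

variable {ι : Type}

/-- `r t i` is the position at time `t` of robot `i`, which slides continuously on its segment
`s i` during the time interval `[0, T]`. -/
def IsMotion (s : ι → SlidingSegment) (T : ℝ) (r : ℝ → ι → ℝ) : Prop :=
  0 ≤ T ∧ (∀ i, ContinuousOn (fun t => r t i) (Icc 0 T)) ∧
    ∀ t ∈ Icc 0 T, ∀ i, r t i ∈ Icc (s i).lo (s i).hi

/-- The motion `r` of the robots in `U` clears `P`: every evader, moving along an arbitrary
continuous curve in `P` (hence at any speed), is at some time seen by a robot in `U`. -/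
def Clears (P : OrthogonalPolygon) (s : ι → SlidingSegment) (U : Set ι) (T : ℝ)
    (r : ℝ → ι → ℝ) : Prop :=
  ∀ γ : ℝ → Pt, ContinuousOn γ (Icc 0 T) → MapsTo γ (Icc 0 T) P.region →
    ∃ t ∈ Icc 0 T, ∃ i ∈ U, γ t ∈ sight P (s i) (r t i)

variable [Fintype ι]

/-- Duration of the motion that visits `c` and then the listed configurations in turn, each leg at
unit speed. (In the runs below only one robot moves in each leg.) -/
noncomputable def duration : (ι → ℝ) → List (ι → ℝ) → ℝ
  | _, [] => 0
  | c, d :: l => dist c d + duration d l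

/-- The motion that visits `c` and then the listed configurations in turn, each leg at unit
speed. -/
noncomputable def follow : (ι → ℝ) → List (ι → ℝ) → ℝ → ι → ℝ
  | c, [], _ => c
  | c, d :: l, t =>
      if t ≤ dist c d then AffineMap.lineMap c d (t / dist c d) else follow d l (t - dist c d)

end Motion

/-- `P` can be cleared by `m` sliding robots on some segments in `P`. -/
def ClearableBy (P : OrthogonalPolygon) (m : ℕ) : Prop :=
  ∃ s : Fin m → SlidingSegment, (∀ i, (s i).carrier ⊆ P.region) ∧
    ∃ (T : ℝ) (r : ℝ → Fin m → ℝ), IsMotion s T r ∧ Clears P s univ T r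

/-! ## The motion-planning algorithm -/

section Algorithm

variable {ι : Type}

/-- `Ahead d a b`: position `b` lies strictly ahead of `a` when moving in direction `d`. -/
def Ahead : Bool → ℝ → ℝ → Prop
  | true, a, b => a < b
  | false, a, b => b < a

/-- The data of a robot that has been called. It sweeps its segment in the given direction. -/
structure Task (ι : Type) where
  robot : ι
  direction : Bool
  /-- the sub-polygon that the robot was asked to clear -/
  region : Set Pt
  /-- the part of it that still has to be cleared -/
  todo : Set Pt

/-- A state of the algorithm: the positions of all robots and the stack of the robots that have
been called. The first one is active; every other one is waiting for the sub-polygon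
`region` of its predecessor in the list. -/
structure State (ι : Type) where
  pos : ι → ℝ
  tasks : List (Task ι)

open Classical in
/-- The configuration `pos` with robot `i` moved to `u`. -/
noncomputable def place (pos : ι → ℝ) (i : ι) (u : ℝ) : ι → ℝ :=
  fun k => if k = i then u else pos k

/-- Start step: the robot `i` is at an endpoint of its segment and has to clear all of `P`; the
other robots are anywhere on their segments. -/
def IsStart (P : OrthogonalPolygon) (s : ι → SlidingSegment) (i : ι) (x : State ι) : Prop :=
  (∀ k, x.pos k ∈ Icc (s k).lo (s k).hi) ∧
    ∃ d : Bool, x.pos i = (s i).first d ∧ x.tasks = [⟨i, d, P.region, P.region⟩]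

/-- `W` is one of the pieces into which the line of sight `ℓ` cuts the set `A`. -/
def IsPiece (A ℓ W : Set Pt) : Prop :=
  ∃ p ∈ A \ ℓ, W = connectedComponentIn (A \ ℓ) p

/-- Position `u` is an event point of the active robot of task `τ`: there it sees a reflex vertex,
or it sees a waiting robot, or it is at the endpoint of its segment. -/
def IsEvent (P : OrthogonalPolygon) (s : ι → SlidingSegment) (pos : ι → ℝ) (τ : Task ι)
    (waiting : List (Task ι)) (u : ℝ) : Prop :=
  (∃ j, P.IsReflex j ∧ P.vertex j ∈ sight P (s τ.robot) u) ∨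
  (∃ σ ∈ waiting, (s σ.robot).point (pos σ.robot) ∈ sight P (s τ.robot) u) ∨
  u = (s τ.robot).last τ.direction

/-- The next event point of the active robot. -/
def IsNextEvent (P : OrthogonalPolygon) (s : ι → SlidingSegment) (pos : ι → ℝ) (τ : Task ι)
    (waiting : List (Task ι)) (u : ℝ) : Prop :=
  u ∈ Icc (s τ.robot).lo (s τ.robot).hi ∧ Ahead τ.direction (pos τ.robot) u ∧
    IsEvent P s pos τ waiting u ∧
    ∀ v, Ahead τ.direction (pos τ.robot) v → Ahead τ.direction v u →
      ¬ IsEvent P s pos τ waiting v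

/-- One step of the algorithm. -/
inductive Step (P : OrthogonalPolygon) (s : ι → SlidingSegment) : State ι → State ι → Prop
  /-- The active robot stops, because its line of sight cuts off a piece `W` of what it has to
  clear that no position of its segment sees, and it sends a signal. A robot `j` that has not been
  called and sees a part of `W` takes over: it goes to a position `c` of its segment, before which
  (in its chosen direction) it sees nothing of `W`. -/
  | signal (pos : ι → ℝ) (τ : Task ι) (rest : List (Task ι)) (W : Set Pt) (j : ι) (d : Bool)
      (c : ℝ)
      (piece : IsPiece τ.todo (sight P (s τ.robot) (pos τ.robot)) W)
      (unseen : Disjoint W (visibility P (s τ.robot)))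
      (free : ∀ σ ∈ τ :: rest, σ.robot ≠ j)
      (sees : (W ∩ visibility P (s j)).Nonempty)
      (mem : c ∈ Icc (s j).lo (s j).hi)
      (before : ∀ u ∈ Icc (s j).lo (s j).hi, Ahead d u c → Disjoint W (sight P (s j) u)) :
      Step P s ⟨pos, τ :: rest⟩ ⟨place pos j c, ⟨j, d, W, W⟩ :: τ :: rest⟩
  /-- If something is left to clear, and no piece is cut off in this way, then the active robot
  moves to its next event point and clears what it sees on its way. -/
  | advance (pos : ι → ℝ) (τ : Task ι) (rest : List (Task ι)) (u : ℝ)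
      (left : (τ.todo \ sight P (s τ.robot) (pos τ.robot)).Nonempty)
      (noPiece : ∀ W, IsPiece τ.todo (sight P (s τ.robot) (pos τ.robot)) W →
        ¬ Disjoint W (visibility P (s τ.robot)))
      (next : IsNextEvent P s pos τ rest u) :
      Step P s ⟨pos, τ :: rest⟩
        ⟨place pos τ.robot u,
          { τ with todo := τ.todo \ ⋃ v ∈ uIcc (pos τ.robot) u, sight P (s τ.robot) v } :: rest⟩
  /-- If nothing is left to clear, then the active robot moves back along its segment, and the
  robot that called it resumes, with that sub-polygon cleared. -/
  | finish (pos : ι → ℝ) (τ σ : Task ι) (rest : List (Task ι)) (b : ℝ)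
      (cleared : τ.todo ⊆ sight P (s τ.robot) (pos τ.robot))
      (mem : b ∈ Icc (s τ.robot).lo (s τ.robot).hi)
      (back : ¬ Ahead τ.direction (pos τ.robot) b) :
      Step P s ⟨pos, τ :: σ :: rest⟩
        ⟨place pos τ.robot b, { σ with todo := σ.todo \ τ.region } :: rest⟩
  /-- Termination step: the same for the robot that started; no robot is waiting any more. -/
  | terminate (pos : ι → ℝ) (τ : Task ι) (b : ℝ)
      (cleared : τ.todo ⊆ sight P (s τ.robot) (pos τ.robot))
      (mem : b ∈ Icc (s τ.robot).lo (s τ.robot).hi)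
      (back : ¬ Ahead τ.direction (pos τ.robot) b) :
      Step P s ⟨pos, [τ]⟩ ⟨place pos τ.robot b, []⟩

/-- `Run P s x l`: from the state `x`, the algorithm passes through the states in `l`, in this
order, and has then terminated. -/
inductive Run (P : OrthogonalPolygon) (s : ι → SlidingSegment) : State ι → List (State ι) → Prop
  | done (pos : ι → ℝ) : Run P s ⟨pos, []⟩ []
  | step (x y : State ι) (l : List (State ι)) (hxy : Step P s x y) (hy : Run P s y l) :
      Run P s x (y :: l)

/-- The robots that are used (called) in the listed states; all other robots stand still. -/
def robotsUsed (l : List (State ι)) : Set ι :=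
  {i | ∃ x ∈ l, ∃ τ ∈ x.tasks, τ.robot = i}

end Algorithm

end SlidingRobots

open SlidingRobots

/-! The algorithm is a recursive search in which lines of sight act as doors. Its invariant
(`StateInv`) says that the region and the remaining part of every called robot are bounded, inside
$P$, only by current lines of sight of robots on the stack: elsewhere membership is locally constant
(`LocallyConstIn`). Hence a continuous evader that is never seen cannot leave the contaminated set,
which is all of $P$ at the start and empty at the end.

The delicate step is the advance (`eventually_mem_diff_sweep`): swept ground is recontaminated only
if part of the remaining set stays hidden near a swept point. Strictly between event points no
reflex vertex is seen, and then points near a seen point are seen too (`eventually_mem_seen`). At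
the starting position reflex vertices may occur, but every piece cut off there has a point seen from
the segment. Since a line of sight separates the positions before it from those behind it
(`not_chain_across_sight`), the parts of such a piece close to the line are seen from positions
ahead (`eventually_seen_ahead`).

Separation is where simplicity of the boundary enters. A chain in $P$ around a line of sight, closed
by a piece of the robot's segment, would have different winding numbers about two exterior points
just beyond the ends of that line. But the winding number is locally constant on the exterior and
has a single value near the boundary (`exists_const_near_frontier`), which is connected and never
branches.

A piece that triggers a signal is invisible to all robots on the stack but guarded by $S$, so a free
robot can be called: no deadlock. Termination is a lexicographic descent in free robots, event
points ahead and pieces (`acc_of_acc_finish`). For optimality, a motionless evader shows that the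
segments of any clearing team guard $P$, so the team has at least $|S|$ members, while the algorithm
calls at most $|S|$ robots. -/

namespace SlidingRobots
open Filter Topology

/-! ### Locally constant membership -/

/-- Membership in `A` is locally constant, relative to `K`, at the points of `K` outside `L`. -/
def LocallyConstIn (K L A : Set Pt) : Prop :=
  ∀ p ∈ K, p ∉ L → ∀ᶠ q in 𝓝[K] p, (q ∈ A ↔ p ∈ A)

theorem mem_of_locally_const {X : Type*} [TopologicalSpace X] {s : Set X} (hs : IsPreconnected s)
    {p : X → Prop} (h : ∀ x ∈ s, ∀ᶠ y in 𝓝[s] x, (p y ↔ p x)) {x y : X} (hx : x ∈ s) (hy : y ∈ s) :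
    p x ↔ p y :=
  hs.induction₂' (fun x y => (p x ↔ p y))
    (fun x hx => (h x hx).mono fun _ h => ⟨h.symm, h⟩)
    (fun _ _ _ _ _ _ h₁ h₂ => h₁.trans h₂) hx hy

namespace LocallyConstIn

variable {K L L' A B : Set Pt}

theorem mono (h : LocallyConstIn K L A) (hL : L ⊆ L') : LocallyConstIn K L' A :=
  fun p hp hpL => h p hp fun h' => hpL (hL h')

theorem union (hA : LocallyConstIn K L A) (hB : LocallyConstIn K L B) :
    LocallyConstIn K L (A ∪ B) := by
  intro p hp hpL
  filter_upwards [hA p hp hpL, hB p hp hpL] with q h₁ h₂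
  simp [h₁, h₂]

theorem diff (hA : LocallyConstIn K L A) (hB : LocallyConstIn K L B) :
    LocallyConstIn K L (A \ B) := by
  intro p hp hpL
  filter_upwards [hA p hp hpL, hB p hp hpL] with q h₁ h₂
  simp [h₁, h₂]

theorem refl (K L : Set Pt) : LocallyConstIn K L K := by
  intro p hp _
  filter_upwards [self_mem_nhdsWithin] with q hq
  simp [hp, show q ∈ K from hq]

theorem empty (K L : Set Pt) : LocallyConstIn K L ∅ := by
  intro p _ _
  simp

theorem of_isClosed {C : Set Pt} (hC : IsClosed C) (hCL : C ⊆ L) : LocallyConstIn K L C := by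
  intro p _ hpL
  have : Cᶜ ∈ 𝓝 p := hC.isOpen_compl.mem_nhds fun h => hpL (hCL h)
  filter_upwards [mem_nhdsWithin_of_mem_nhds this] with q hq
  simp only [show q ∉ C from hq, false_iff]
  exact fun h => hpL (hCL h)

/-- A curve that avoids `L` does not leave or enter `A`. -/
theorem mem_iff_of_curve (h : LocallyConstIn K L A) {γ : ℝ → Pt} {a b : ℝ}
    (hγ : ContinuousOn γ (Icc a b)) (hK : MapsTo γ (Icc a b) K) (hL : ∀ t ∈ Icc a b, γ t ∉ L)
    (hab : a ≤ b) : γ a ∈ A ↔ γ b ∈ A := by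
  refine mem_of_locally_const (p := fun t => γ t ∈ A) isPreconnected_Icc (fun t ht => ?_)
    (left_mem_Icc.2 hab) (right_mem_Icc.2 hab)
  exact ((hγ t ht).tendsto_nhdsWithin hK).eventually (h _ (hK ht) (hL t ht))

end LocallyConstIn

/-! ### Sets that are unions of cells of a finite grid -/

/-- `a` and `b` have the same position relative to all elements of `F`. -/
def SameSide (F : Finset ℝ) (a b : ℝ) : Prop :=
  ∀ f ∈ F, (a < f ↔ b < f) ∧ (f < a ↔ f < b)

/-- `p` and `q` lie in the same cell of the grid with the coordinates in `F`. -/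
def SameCell (F : Finset ℝ) (p q : Pt) : Prop :=
  SameSide F p.1 q.1 ∧ SameSide F p.2 q.2

/-- `A` is a union of cells of the grid with the coordinates in `F`. -/
def TameFor (F : Finset ℝ) (A : Set Pt) : Prop :=
  ∀ p q, SameCell F p q → p ∈ A → q ∈ A

/-- `A` is a union of cells of a finite grid. -/
def Tame (A : Set Pt) : Prop := ∃ F, TameFor F A

namespace SameSide

variable {F G : Finset ℝ} {a b c : ℝ}

theorem refl (F : Finset ℝ) (a : ℝ) : SameSide F a a := fun _ _ => ⟨Iff.rfl, Iff.rfl⟩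

theorem symm (h : SameSide F a b) : SameSide F b a :=
  fun f hf => ⟨(h f hf).1.symm, (h f hf).2.symm⟩

theorem trans (h : SameSide F a b) (h' : SameSide F b c) : SameSide F a c :=
  fun f hf => ⟨(h f hf).1.trans (h' f hf).1, (h f hf).2.trans (h' f hf).2⟩

theorem mono (hFG : F ⊆ G) (h : SameSide G a b) : SameSide F a b := fun f hf => h f (hFG hf)

theorem of_mem_uIcc (h : SameSide F a b) (hc : c ∈ uIcc a b) : SameSide F a c := by
  intro f hf
  have := h f hf
  rw [mem_uIcc] at hc
  grind

theorem eventually_strict (F : Finset ℝ) (a : ℝ) :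
    ∀ᶠ b in 𝓝 a, ∀ f ∈ F, (a < f → b < f) ∧ (f < a → f < b) := by
  refine (eventually_all_finset F).2 fun f _ => ?_
  refine Eventually.and ?_ ?_
  · by_cases h : a < f
    · exact (eventually_lt_nhds h).mono fun _ h _ => h
    · simp [h]
  · by_cases h : f < a
    · exact (eventually_gt_nhds h).mono fun _ h _ => h
    · simp [h]

/-- Points between a point and a point close to it are in the same position as the latter. -/
theorem eventually (F : Finset ℝ) (a : ℝ) :
    ∀ᶠ b in 𝓝 a, ∀ t ∈ Ioc (0 : ℝ) 1, SameSide F b (a + t * (b - a)) := by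
  filter_upwards [eventually_strict F a] with b hb t ht f hf
  obtain ⟨h₁, h₂⟩ := hb f hf
  obtain ⟨ht₀, ht₁⟩ := ht
  rcases lt_trichotomy a f with h | h | h
  · have := h₁ h
    have : a + t * (b - a) < f := by nlinarith
    constructor <;> constructor <;> intro <;> linarith
  · subst h
    constructor <;> constructor <;> intro h' <;> nlinarith
  · have := h₂ h
    have : f < a + t * (b - a) := by nlinarith
    constructor <;> constructor <;> intro <;> linarith

end SameSide

namespace SameCell

variable {F G : Finset ℝ} {p q r : Pt}

theorem symm (h : SameCell F p q) : SameCell F q p := ⟨h.1.symm, h.2.symm⟩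

theorem trans (h : SameCell F p q) (h' : SameCell F q r) : SameCell F p r :=
  ⟨h.1.trans h'.1, h.2.trans h'.2⟩

theorem mono (hFG : F ⊆ G) (h : SameCell G p q) : SameCell F p q := ⟨h.1.mono hFG, h.2.mono hFG⟩

theorem of_mem_segment (h : SameCell F p q) (hr : r ∈ segment ℝ p q) : SameCell F p r := by
  have hr' := Prod.segment_subset _ _ hr
  rw [segment_eq_uIcc, segment_eq_uIcc] at hr'
  exact ⟨h.1.of_mem_uIcc hr'.1, h.2.of_mem_uIcc hr'.2⟩

theorem eventually (F : Finset ℝ) (p : Pt) :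
    ∀ᶠ q in 𝓝 p, ∀ t ∈ Ioc (0 : ℝ) 1, SameCell F q (p + t • (q - p)) := by
  have h₁ : Tendsto Prod.fst (𝓝 p) (𝓝 p.1) := continuous_fst.continuousAt
  have h₂ : Tendsto Prod.snd (𝓝 p) (𝓝 p.2) := continuous_snd.continuousAt
  filter_upwards [h₁.eventually (SameSide.eventually F p.1),
    h₂.eventually (SameSide.eventually F p.2)] with q hq₁ hq₂ t ht
  exact ⟨hq₁ t ht, hq₂ t ht⟩

end SameCell

theorem TameFor.mono {F G : Finset ℝ} {A : Set Pt} (hFG : F ⊆ G) (h : TameFor F A) : TameFor G A :=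
  fun p q hpq => h p q (hpq.mono hFG)

theorem TameFor.mem_iff {F : Finset ℝ} {A : Set Pt} (h : TameFor F A) {p q : Pt}
    (hpq : SameCell F p q) : p ∈ A ↔ q ∈ A :=
  ⟨h p q hpq, h q p hpq.symm⟩

namespace Tame

variable {A B : Set Pt}

theorem of_boolean {C : Set Pt} (hA : Tame A) (hB : Tame B) (φ : Prop → Prop → Prop)
    (hC : ∀ p, p ∈ C ↔ φ (p ∈ A) (p ∈ B)) : Tame C := by
  classical
  obtain ⟨F, hF⟩ := hA
  obtain ⟨G, hG⟩ := hB
  refine ⟨F ∪ G, fun p q hpq hp => ?_⟩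
  rw [hC] at hp ⊢
  rwa [← (hF.mono Finset.subset_union_left).mem_iff hpq,
    ← (hG.mono Finset.subset_union_right).mem_iff hpq]

theorem diff (hA : Tame A) (hB : Tame B) : Tame (A \ B) :=
  hA.of_boolean hB (fun a b => a ∧ ¬ b) fun _ => Iff.rfl

/-- Close to a point, membership is constant along rays from this point. -/
theorem eventually_ray (hA : Tame A) (p : Pt) :
    ∀ᶠ q in 𝓝 p, ∀ t ∈ Ioc (0 : ℝ) 1, (p + t • (q - p) ∈ A ↔ q ∈ A) := by
  obtain ⟨F, hF⟩ := hA
  filter_upwards [SameCell.eventually F p] with q hq t ht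
  exact (hF.mem_iff (hq t ht)).symm

/-- A tame set is locally conical, hence locally star-shaped about each of its points. -/
theorem eventually_segment_subset (hA : Tame A) {p : Pt} (hp : p ∈ A) :
    ∀ᶠ q in 𝓝[A] p, segment ℝ p q ⊆ A := by
  filter_upwards [mem_nhdsWithin_of_mem_nhds (hA.eventually_ray p), self_mem_nhdsWithin]
    with q hq hqA
  rw [segment_eq_image']
  rintro _ ⟨t, ⟨h₀, h₁⟩, rfl⟩
  rcases h₀.eq_or_lt with rfl | h₀
  · simpa using hp
  · exact (hq t ⟨h₀, h₁⟩).2 hqA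

/-- Cells are boxes, hence convex: two points of a cell inside `A` are joined by a segment in `A`.
-/
theorem connectedComponentIn_eq_of_sameCell {F : Finset ℝ} (hF : TameFor F A) {p q : Pt}
    (hp : p ∈ A) (hpq : SameCell F p q) :
    connectedComponentIn A p = connectedComponentIn A q := by
  refine (connectedComponentIn_eq ?_)
  have hsub : segment ℝ p q ⊆ A := fun r hr => hF _ _ (hpq.of_mem_segment hr) hp
  exact (convex_segment p q).isPreconnected.subset_connectedComponentIn
    (left_mem_segment ℝ p q) hsub (right_mem_segment ℝ p q)

theorem connectedComponentIn (hA : Tame A) (p : Pt) : Tame (connectedComponentIn A p) := by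
  obtain ⟨F, hF⟩ := hA
  refine ⟨F, fun q r hqr hq => ?_⟩
  have hqA := connectedComponentIn_subset _ _ hq
  have h := connectedComponentIn_eq hq
  rw [h, connectedComponentIn_eq_of_sameCell hF hqA hqr]
  exact mem_connectedComponentIn (hF _ _ hqr hqA)

/-- A component is determined by the cell of any of its points. The cell is encoded by the pattern
of comparisons with the grid coordinates, and there are finitely many patterns. -/
theorem finite_components (hA : Tame A) :
    {W | ∃ p ∈ A, W = _root_.connectedComponentIn A p}.Finite := by
  obtain ⟨F, hF⟩ := hA
  let key : Pt → (F → Prop × Prop × Prop × Prop) :=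
    fun p f => (p.1 < f, f < p.1, p.2 < f, f < p.2)
  have hkey : ∀ p q, key p = key q → SameCell F p q := by
    intro p q h
    refine ⟨fun f hf => ?_, fun f hf => ?_⟩ <;>
    · have := congrFun h ⟨f, hf⟩
      simp only [key, Prod.mk.injEq, eq_iff_iff] at this
      tauto
  refine (finite_range fun k => _root_.connectedComponentIn A (Function.invFun key k)).subset ?_
  rintro _ ⟨p, hp, rfl⟩
  refine ⟨key p, ?_⟩
  have : key (Function.invFun key (key p)) = key p := Function.invFun_eq ⟨p, rfl⟩
  exact (connectedComponentIn_eq_of_sameCell hF hp (hkey _ _ this.symm)).symm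

/-- Components of tame sets are connected by polygonal chains. -/
theorem reflTransGen_of_mem_connectedComponentIn (hA : Tame A) {p q : Pt} (hp : p ∈ A)
    (hq : q ∈ _root_.connectedComponentIn A p) :
    Relation.ReflTransGen (fun x y => segment ℝ x y ⊆ A) p q := by
  refine isPreconnected_connectedComponentIn.induction₂'
    (fun x y => Relation.ReflTransGen (fun x y => segment ℝ x y ⊆ A) x y) (fun x hx => ?_)
    (fun _ _ _ _ _ _ h₁ h₂ => h₁.trans h₂) (mem_connectedComponentIn hp) hq
  have hxA := connectedComponentIn_subset _ _ hx
  filter_upwards [nhdsWithin_mono x (connectedComponentIn_subset A p)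
    (hA.eventually_segment_subset hxA)] with y hy
  exact ⟨.single hy, .single (segment_symm ℝ x y ▸ hy)⟩

end Tame

/-- A component of a set with locally constant membership has the same property. -/
theorem LocallyConstIn.connectedComponentIn {K L A : Set Pt} (hK : Tame K)
    (h : LocallyConstIn K L A) (x : Pt) : LocallyConstIn K L (connectedComponentIn A x) := by
  intro p hp hpL
  by_cases hpA : p ∈ A
  · have hA := h p hp hpL
    simp only [hpA, iff_true] at hA
    obtain ⟨ε, hε, hball⟩ := Metric.mem_nhdsWithin_iff.1 hA
    have hball' : Metric.ball p ε ∩ K ∈ 𝓝[K] p :=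
      inter_mem (mem_nhdsWithin_of_mem_nhds (Metric.ball_mem_nhds p hε)) self_mem_nhdsWithin
    filter_upwards [hK.eventually_segment_subset hp, hball'] with q hq hqb
    -- Near `p` the set `K` is star-shaped about `p`, and inside the ball it is contained in `A`; so
    -- nearby points of `K` lie in the component of `p`.
    have hsub : segment ℝ p q ⊆ A := fun r hr =>
      hball ⟨(convex_ball p ε).segment_subset (Metric.mem_ball_self hε) hqb.1 hr, hq hr⟩
    have hqc := (convex_segment p q).isPreconnected.subset_connectedComponentIn
      (left_mem_segment ℝ p q) hsub (right_mem_segment ℝ p q)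
    constructor
    · intro hq'
      rw [connectedComponentIn_eq hq', ← connectedComponentIn_eq hqc]
      exact mem_connectedComponentIn hpA
    · intro hp'
      rwa [connectedComponentIn_eq hp']
  · filter_upwards [h p hp hpL] with q hq
    have hqA : q ∉ A := fun h' => hpA (hq.1 h')
    exact iff_of_false (fun h' => hqA (connectedComponentIn_subset _ _ h'))
      (fun h' => hpA (connectedComponentIn_subset _ _ h'))

theorem mem_closure_of_ray {K : Set Pt} {x v : Pt} (h : ∀ t ∈ Ioc (0 : ℝ) 1, x + t • v ∈ K) :
    x ∈ closure K := by
  have hc : Tendsto (fun t : ℝ => x + t • v) (𝓝[>] 0) (𝓝 x) := by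
    have : Continuous fun t : ℝ => x + t • v := by fun_prop
    simpa using (this.tendsto 0).mono_left nhdsWithin_le_nhds
  refine mem_closure_of_tendsto hc ?_
  filter_upwards [Ioc_mem_nhdsGT (zero_lt_one' ℝ)] with t ht using h t ht

theorem isCompact_segment (x y : Pt) : IsCompact (segment ℝ x y) := by
  rw [segment_eq_image']
  exact isCompact_Icc.image (by fun_prop)

/-! ### Edges, connected boundary and grid structure of a polygon -/

namespace OrthogonalPolygon

variable (P : OrthogonalPolygon)

/-- The edge from the vertex with index `j` to the next one. -/
def edge (j : ZMod P.n) : Set Pt := segment ℝ (P.vertex j) (P.vertex (j + 1))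

theorem isClosed_region : IsClosed P.region := P.isCompact_region.isClosed

instance : NeZero P.n := ⟨by have := P.four_le; omega⟩

theorem frontier_eq : frontier P.region = ⋃ j, P.edge j := P.frontier_region

theorem isClosed_edge (j : ZMod P.n) : IsClosed (P.edge j) :=
  (isCompact_segment _ _).isClosed

/-- One factor is degenerate because edges are axis-parallel; as boxes, edges are visibly unions of
grid cells. -/
theorem edge_eq (j : ZMod P.n) : P.edge j =
    uIcc (P.vertex j).1 (P.vertex (j + 1)).1 ×ˢ uIcc (P.vertex j).2 (P.vertex (j + 1)).2 := by
  refine Subset.antisymm (fun r hr => ?_) (fun r hr => ?_)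
  · simpa only [segment_eq_uIcc] using Prod.segment_subset _ _ hr
  · obtain ⟨h₁, h₂⟩ := hr
    rw [← segment_eq_uIcc] at h₁ h₂
    unfold edge
    rcases P.orthogonal j with h | h
    · have e : r.2 = (P.vertex j).2 := by simpa [← h.1] using h₂
      have := mem_image_of_mem (fun x => (x, (P.vertex j).2)) h₁
      rw [Prod.image_mk_segment_left] at this
      nth_rw 2 [h.1] at this
      rwa [show r = (r.1, (P.vertex j).2) from Prod.ext rfl e]
    · have e : r.1 = (P.vertex j).1 := by simpa [← h.1] using h₁
      have := mem_image_of_mem (fun x => ((P.vertex j).1, x)) h₂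
      rw [Prod.image_mk_segment_right] at this
      nth_rw 2 [h.1] at this
      rwa [show r = ((P.vertex j).1, r.2) from Prod.ext e rfl]

theorem isPreconnected_frontier : IsPreconnected (frontier P.region) := by
  rw [frontier_eq]
  refine IsPreconnected.iUnion_of_reflTransGen
    (fun j => (convex_segment _ _).isPreconnected) fun i j => ?_
  have step : ∀ k : ℕ, Relation.ReflTransGen
      (fun i j => (P.edge i ∩ P.edge j).Nonempty) i (i + k) := by
    intro k
    induction k with
    | zero => simpa using .refl
    | succ k ih =>
      refine ih.tail ⟨P.vertex (i + k + 1), right_mem_segment ℝ _ _, ?_⟩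
      have : i + ((k + 1 : ℕ) : ZMod P.n) = i + k + 1 := by push_cast; ring
      rw [this]
      exact left_mem_segment ℝ _ _
  have := step (j - i).val
  rwa [ZMod.natCast_zmod_val, add_sub_cancel] at this

/-- The coordinates of the vertices. -/
noncomputable def coords : Finset ℝ :=
  Finset.univ.image (fun j => (P.vertex j).1) ∪ Finset.univ.image (fun j => (P.vertex j).2)

theorem fst_mem_coords (j : ZMod P.n) : (P.vertex j).1 ∈ P.coords :=
  Finset.mem_union_left _ (Finset.mem_image_of_mem _ (Finset.mem_univ j))

theorem snd_mem_coords (j : ZMod P.n) : (P.vertex j).2 ∈ P.coords :=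
  Finset.mem_union_right _ (Finset.mem_image_of_mem _ (Finset.mem_univ j))

theorem tameFor_frontier : TameFor P.coords (frontier P.region) := by
  intro p q hpq hp
  rw [frontier_eq, mem_iUnion] at hp ⊢
  obtain ⟨j, hj⟩ := hp
  refine ⟨j, ?_⟩
  rw [edge_eq] at hj ⊢
  obtain ⟨h₁, h₂⟩ := hj
  have a₁ := hpq.1 _ (P.fst_mem_coords j)
  have a₂ := hpq.1 _ (P.fst_mem_coords (j + 1))
  have b₁ := hpq.2 _ (P.snd_mem_coords j)
  have b₂ := hpq.2 _ (P.snd_mem_coords (j + 1))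
  refine ⟨?_, ?_⟩ <;> rw [mem_uIcc] at * <;> grind

/-- If the segment between two points of a cell meets the boundary, the whole cell lies in the
boundary and so in the closed region. Otherwise membership is constant along the segment. -/
theorem tameFor_region : TameFor P.coords P.region := by
  intro p q hpq hp
  by_cases h : ∃ r ∈ segment ℝ p q, r ∈ frontier P.region
  · obtain ⟨r, hr, hrf⟩ := h
    have hq := P.tameFor_frontier r q ((hpq.of_mem_segment hr).symm.trans hpq) hrf
    exact P.isClosed_region.frontier_subset hq
  · push Not at h
    refine (mem_of_locally_const (convex_segment p q).isPreconnected (p := (· ∈ P.region))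
      (fun x hx => ?_) (left_mem_segment ℝ p q) (right_mem_segment ℝ p q)).1 hp
    refine mem_nhdsWithin_of_mem_nhds ?_
    have hx := h x hx
    by_cases hxR : x ∈ P.region
    · have : x ∈ interior P.region := by
        by_contra h'
        exact hx ⟨subset_closure hxR, h'⟩
      filter_upwards [mem_interior_iff_mem_nhds.1 this] with y hy
      exact iff_of_true hy hxR
    · filter_upwards [P.isClosed_region.isOpen_compl.mem_nhds hxR] with y hy
      exact iff_of_false hy hxR

theorem tame_region : Tame P.region := ⟨_, P.tameFor_region⟩

/-! ### Corners -/

variable {P}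

/-- Finitely many closed edges cover the boundary, so one of them contains points of the ray
arbitrarily close to `c`, and therefore `c` itself. -/
theorem exists_edge_of_frequently {c d : Pt}
    (h : ∃ᶠ t in 𝓝[>] (0 : ℝ), c + t • d ∈ frontier P.region) :
    ∃ j, c ∈ P.edge j ∧ ∃ t > (0 : ℝ), c + t • d ∈ P.edge j := by
  simp only [frontier_eq, mem_iUnion, frequently_exists] at h
  obtain ⟨j, hj⟩ := h
  refine ⟨j, ?_, ?_⟩
  · have hc : Tendsto (fun t : ℝ => c + t • d) (𝓝[>] 0) (𝓝 c) := by
      have : Continuous fun t : ℝ => c + t • d := by fun_prop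
      simpa using (this.tendsto 0).mono_left nhdsWithin_le_nhds
    exact (P.isClosed_edge j).mem_of_frequently_of_tendsto hj hc
  · obtain ⟨t, h₁, h₂⟩ := (hj.and_eventually self_mem_nhdsWithin).exists
    exact ⟨t, h₂, h₁⟩

theorem horizontal_of_mem {c d : Pt} (hd : d.1 ≠ 0) {j : ZMod P.n} (hc : c ∈ P.edge j) {t : ℝ}
    (ht : t ≠ 0) (hcd : c + t • d ∈ P.edge j) : (P.vertex j).2 = (P.vertex (j + 1)).2 := by
  rcases P.orthogonal j with h | h
  · exact h.1
  · rw [edge_eq] at hc hcd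
    have h₁ := hc.1
    have h₂ := hcd.1
    simp only [h.1, uIcc_self, mem_singleton_iff] at h₁ h₂
    simp [h₁, ht, hd] at h₂

theorem vertical_of_mem {c d : Pt} (hd : d.2 ≠ 0) {j : ZMod P.n} (hc : c ∈ P.edge j) {t : ℝ}
    (ht : t ≠ 0) (hcd : c + t • d ∈ P.edge j) : (P.vertex j).1 = (P.vertex (j + 1)).1 := by
  rcases P.orthogonal j with h | h
  · rw [edge_eq] at hc hcd
    have h₁ := hc.2
    have h₂ := hcd.2
    simp only [h.1, uIcc_self, mem_singleton_iff] at h₁ h₂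
    simp [h₁, ht, hd] at h₂
  · exact h.1

/-- The first edge is horizontal and the second vertical, so they differ; since they share `c`,
simplicity forces them to be consecutive and to meet in a vertex. -/
theorem common_vertex {c d e : Pt} (hd : d.1 ≠ 0) (he : e.2 ≠ 0) {i k : ZMod P.n}
    (hi : c ∈ P.edge i) (hk : c ∈ P.edge k) {t s : ℝ} (ht : t ≠ 0) (hs : s ≠ 0)
    (hid : c + t • d ∈ P.edge i) (hke : c + s • e ∈ P.edge k) :
    (k = i + 1 ∧ c = P.vertex k) ∨ (i = k + 1 ∧ c = P.vertex i) := by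
  have h₁ := horizontal_of_mem hd hi ht hid
  have h₂ := vertical_of_mem he hk hs hke
  have hik : i ≠ k := by
    rintro rfl
    exact P.vertex_ne i (Prod.ext h₂ h₁)
  by_cases hki : k = i + 1
  · left
    subst hki
    have : c ∈ P.edge i ∩ P.edge (i + 1) := ⟨hi, hk⟩
    unfold edge at this
    rw [add_assoc, one_add_one_eq_two, P.adjacent i] at this
    exact ⟨rfl, this⟩
  by_cases hki' : i = k + 1
  · right
    subst hki'
    have : c ∈ P.edge k ∩ P.edge (k + 1) := ⟨hk, hi⟩
    unfold edge at this
    rw [add_assoc, one_add_one_eq_two, P.adjacent k] at this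
    exact ⟨rfl, this⟩
  exact absurd hk (disjoint_left.1 (P.simple i k hik hki hki') hi)

theorem exists_pos_smul_of_mem_segment {c x d : Pt} (hd : d ≠ 0) {t : ℝ} (ht : 0 < t)
    (h : c + t • d ∈ segment ℝ c x) : ∃ s > (0 : ℝ), x - c = s • d := by
  rw [segment_eq_image'] at h
  obtain ⟨τ, ⟨h₀, -⟩, hτ⟩ := h
  have hτ' : τ • (x - c) = t • d := by simpa using hτ
  have hτ₀ : 0 < τ := by
    rcases h₀.eq_or_lt with rfl | h
    · rw [zero_smul, eq_comm, smul_eq_zero] at hτ'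
      exact absurd hτ' (not_or.2 ⟨ht.ne', hd⟩)
    · exact h
  refine ⟨t / τ, by positivity, ?_⟩
  rw [div_eq_inv_mul, mul_smul, ← hτ', smul_smul, inv_mul_cancel₀ hτ₀.ne', one_smul]

/-- The boundary does not leave a point in three perpendicular directions. -/
theorem not_three_germs {c d e : Pt} (hd : d.1 ≠ 0) (he : e.2 ≠ 0)
    (h₁ : ∃ᶠ t in 𝓝[>] (0 : ℝ), c + t • d ∈ frontier P.region)
    (h₂ : ∃ᶠ t in 𝓝[>] (0 : ℝ), c + t • (-d) ∈ frontier P.region)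
    (h₃ : ∃ᶠ t in 𝓝[>] (0 : ℝ), c + t • e ∈ frontier P.region) : False := by
  obtain ⟨i, hi, t, ht, hid⟩ := exists_edge_of_frequently h₁
  obtain ⟨j, hj, s, hs, hjd⟩ := exists_edge_of_frequently h₂
  obtain ⟨k, hk, r, hr, hke⟩ := exists_edge_of_frequently h₃
  have hd₀ : d ≠ 0 := by rintro rfl; simp at hd
  have key : ∀ x : Pt, c + t • d ∈ segment ℝ c x → c + s • (-d) ∈ segment ℝ c x → False := by
    intro x hx hx'
    obtain ⟨a, ha, ha'⟩ := exists_pos_smul_of_mem_segment hd₀ ht hx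
    obtain ⟨b, hb, hb'⟩ := exists_pos_smul_of_mem_segment (neg_ne_zero.2 hd₀) hs hx'
    have : (a + b) • d = 0 := by
      rw [add_smul, ← ha', hb', smul_neg, neg_add_cancel]
    rw [smul_eq_zero] at this
    exact this.elim (by positivity) hd₀
  -- Both horizontal edges are adjacent to the vertical edge `k` at `c`. At the same end of `k` they
  -- would be a single edge leaving its own endpoint in opposite directions; at different ends, `k`
  -- would be degenerate.
  rcases common_vertex hd he hi hk ht.ne' hr.ne' hid hke with ⟨a, a'⟩ | ⟨a, a'⟩ <;>
  rcases common_vertex (d := -d) (by simpa using hd) he hj hk hs.ne' hr.ne' hjd hke with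
    ⟨b, b'⟩ | ⟨b, b'⟩
  · have hij : i = j := add_right_cancel (a.symm.trans b)
    subst hij
    unfold edge at hid hjd
    rw [← a, ← a', segment_symm] at hid hjd
    exact key _ hid hjd
  · subst b
    exact P.vertex_ne k (a'.symm.trans b')
  · subst a
    exact P.vertex_ne k (b'.symm.trans a')
  · have hij : i = j := a.trans b.symm
    subst hij
    unfold edge at hid hjd
    rw [← a'] at hid hjd
    exact key _ hid hjd

/-- A point at which two perpendicular pieces of the boundary meet, with the quadrant between them
outside the polygon, is a reflex vertex. -/
theorem exists_isReflex {c d e : Pt} (hd : d.1 ≠ 0) (he : e.2 ≠ 0)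
    (h₁ : ∀ t ∈ Ioc (0 : ℝ) 1, c + t • d ∈ P.region)
    (h₂ : ∀ t ∈ Ioc (0 : ℝ) 1, c + t • e ∈ P.region)
    (h₃ : ∀ t ∈ Ioc (0 : ℝ) 1, ∀ s ∈ Ioc (0 : ℝ) 1, c + t • d + s • e ∉ P.region) :
    ∃ j, P.IsReflex j ∧ P.vertex j = c := by
  have hIoc : ∀ᶠ t in 𝓝[>] (0 : ℝ), t ∈ Ioc (0 : ℝ) 1 := Ioc_mem_nhdsGT (zero_lt_one' ℝ)
  have f₁ : ∃ᶠ t in 𝓝[>] (0 : ℝ), c + t • d ∈ frontier P.region := by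
    refine (hIoc.mono fun t ht => ?_).frequently
    rw [frontier_eq_closure_inter_closure]
    exact ⟨subset_closure (h₁ t ht), mem_closure_of_ray (h₃ t ht)⟩
  have f₂ : ∃ᶠ t in 𝓝[>] (0 : ℝ), c + t • e ∈ frontier P.region := by
    refine (hIoc.mono fun t ht => ?_).frequently
    rw [frontier_eq_closure_inter_closure]
    refine ⟨subset_closure (h₂ t ht), mem_closure_of_ray (v := d) fun s hs => ?_⟩
    have := h₃ s hs t ht
    rwa [add_right_comm] at this
  obtain ⟨i, hi, t, ht, hid⟩ := exists_edge_of_frequently f₁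
  obtain ⟨k, hk, r, hr, hke⟩ := exists_edge_of_frequently f₂
  have hd₀ : d ≠ 0 := by rintro rfl; simp at hd
  have he₀ : e ≠ 0 := by rintro rfl; simp at he
  -- The edge vectors at `c` will be `s • d` and `u • e`; the choice of `δ` keeps both coefficients
  -- in the unit range where `h₃` applies.
  have key : ∀ s > (0 : ℝ), ∀ u > (0 : ℝ), ∃ δ > (0 : ℝ), ∀ ε, 0 < ε → ε < δ →
      c + ε • (s • d + u • e) ∉ P.region := by
    intro s hs u hu
    refine ⟨min (1 / s) (1 / u), by positivity, fun ε hε hε' => ?_⟩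
    rw [lt_min_iff, lt_div_iff₀ hs, lt_div_iff₀ hu] at hε'
    have := h₃ (ε * s) ⟨by positivity, hε'.1.le⟩ (ε * u) ⟨by positivity, hε'.2.le⟩
    rwa [smul_add, smul_smul, smul_smul, ← add_assoc]
  rcases common_vertex hd he hi hk ht.ne' hr.ne' hid hke with ⟨a, a'⟩ | ⟨a, a'⟩
  · refine ⟨k, ?_, a'.symm⟩
    have hik : i = k - 1 := eq_sub_of_add_eq a.symm
    subst hik
    unfold edge at hid hke
    rw [sub_add_cancel, ← a', segment_symm] at hid
    rw [← a'] at hke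
    obtain ⟨s, hs, hs'⟩ := exists_pos_smul_of_mem_segment hd₀ ht hid
    obtain ⟨u, hu, hu'⟩ := exists_pos_smul_of_mem_segment he₀ hr hke
    unfold IsReflex
    rw [← a', hs', hu']
    exact key s hs u hu
  · refine ⟨i, ?_, a'.symm⟩
    have hik : k = i - 1 := eq_sub_of_add_eq a.symm
    subst hik
    unfold edge at hid hke
    rw [sub_add_cancel, ← a', segment_symm] at hke
    rw [← a'] at hid
    obtain ⟨s, hs, hs'⟩ := exists_pos_smul_of_mem_segment hd₀ ht hid
    obtain ⟨u, hu, hu'⟩ := exists_pos_smul_of_mem_segment he₀ hr hke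
    unfold IsReflex
    rw [← a', hs', hu', add_comm (u • e)]
    exact key s hs u hu

end OrthogonalPolygon
/-! ### Locally constant functions on the exterior of a polygon -/

/-- Close to `a`, two numbers on the same side of `a` are on the same side of all of `F`. -/
theorem exists_sameSide_near (F : Finset ℝ) (a : ℝ) : ∃ ε > (0 : ℝ), ∀ b c, |b - a| < ε →
    |c - a| < ε → SameSide {a} b c → SameSide F b c := by
  obtain ⟨ε, hε, h⟩ := Metric.eventually_nhds_iff.1 (SameSide.eventually_strict F a)
  refine ⟨ε, hε, fun b c hb hc hbc f hf => ?_⟩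
  have h₁ := h (y := b) hb f hf
  have h₂ := h (y := c) hc f hf
  have h₃ := hbc a (by simp)
  grind

theorem sameSide_singleton {a b c : ℝ} (h : 0 < (b - a) * (c - a)) : SameSide {a} b c := by
  intro f hf
  obtain rfl := Finset.mem_singleton.1 hf
  rcases pos_and_pos_or_neg_and_neg_of_mul_pos h with h | h <;>
  constructor <;> constructor <;> intro h' <;> linarith

theorem SameSide.mul_pos {a b c : ℝ} (hb : b ≠ a) (h : SameSide {a} b c) :
    0 < (b - a) * (c - a) := by
  have := h a (by simp)
  rcases hb.lt_or_gt with h | h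
  · have := this.1.1 h
    exact mul_pos_of_neg_of_neg (by linarith) (by linarith)
  · have := this.2.1 h
    exact _root_.mul_pos (by linarith) (by linarith)

theorem sameSide_cases {a b c d : ℝ} (hb : b ≠ a) (hc : c ≠ a) (hd : d ≠ a) :
    SameSide {a} b c ∨ SameSide {a} b d ∨ SameSide {a} c d := by
  have : 0 < (b - a) * (c - a) ∨ 0 < (b - a) * (d - a) ∨ 0 < (c - a) * (d - a) := by
    rcases hb.lt_or_gt with h₁ | h₁ <;> rcases hc.lt_or_gt with h₂ | h₂ <;>
    rcases hd.lt_or_gt with h₃ | h₃ <;>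
    first
    | exact .inl (_root_.mul_pos (by linarith) (by linarith))
    | exact .inr (.inl (_root_.mul_pos (by linarith) (by linarith)))
    | exact .inr (.inr (_root_.mul_pos (by linarith) (by linarith)))
    | exact .inl (mul_pos_of_neg_of_neg (by linarith) (by linarith))
    | exact .inr (.inl (mul_pos_of_neg_of_neg (by linarith) (by linarith)))
    | exact .inr (.inr (mul_pos_of_neg_of_neg (by linarith) (by linarith)))
  exact this.imp sameSide_singleton (Or.imp sameSide_singleton sameSide_singleton)

theorem exists_generic {U : Set Pt} (hU : IsOpen U) (hne : U.Nonempty) (p : Pt) :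
    ∃ z ∈ U, z.1 ≠ p.1 ∧ z.2 ≠ p.2 := by
  have hd : Dense (({p.1}ᶜ : Set ℝ) ×ˢ ({p.2}ᶜ : Set ℝ)) :=
    (dense_compl_singleton p.1).prod (dense_compl_singleton p.2)
  obtain ⟨z, hz, hz'⟩ := hd.inter_open_nonempty U hU hne
  exact ⟨z, hz, hz'.1, hz'.2⟩

namespace OrthogonalPolygon

variable {P : OrthogonalPolygon} {w : Pt → ℝ}

theorem eq_of_isPreconnected (hw : ∀ q ∉ P.region, ∀ᶠ r in 𝓝 q, w r = w q) {C : Set Pt}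
    (hC : IsPreconnected C) (hCP : ∀ x ∈ C, x ∉ P.region) {x y : Pt} (hx : x ∈ C) (hy : y ∈ C) :
    w x = w y :=
  hC.induction₂' (fun x y => w x = w y)
    (fun x hx => mem_nhdsWithin_of_mem_nhds
      ((hw x (hCP x hx)).mono fun _ h => ⟨h.symm, h⟩))
    (fun _ _ _ _ _ _ h₁ h₂ => h₁.trans h₂) hx hy

/-- A locally constant function on the exterior has one value near a boundary point. -/
theorem exists_eventually_const (hw : ∀ q ∉ P.region, ∀ᶠ r in 𝓝 q, w r = w q) (p : Pt)
    (hp : p ∈ frontier P.region) : ∃ c, ∀ᶠ q in 𝓝 p, q ∉ P.region → w q = c := by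
  -- In a small box around `p`, membership in the region depends only on the position relative to
  -- the two axes through `p`.
  obtain ⟨ε₁, hε₁, h₁⟩ := exists_sameSide_near P.coords p.1
  obtain ⟨ε₂, hε₂, h₂⟩ := exists_sameSide_near P.coords p.2
  set U : Set Pt := {q | |q.1 - p.1| < ε₁ ∧ |q.2 - p.2| < ε₂} with hU
  have hUo : IsOpen U := by
    refine IsOpen.inter ?_ ?_
    · exact isOpen_lt (f := fun q : Pt => |q.1 - p.1|) (by fun_prop) continuous_const
    · exact isOpen_lt (f := fun q : Pt => |q.2 - p.2|) (by fun_prop) continuous_const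
  have hpU : p ∈ U := by simp [hU, hε₁, hε₂]
  have hUc : Convex ℝ U := by
    have : U = Metric.ball p.1 ε₁ ×ˢ Metric.ball p.2 ε₂ := by
      ext q; simp [hU, Real.dist_eq]
    rw [this]
    exact (convex_ball _ _).prod (convex_ball _ _)
  have cell : ∀ x ∈ U, ∀ y ∈ U, SameSide {p.1} x.1 y.1 → SameSide {p.2} x.2 y.2 →
      (x ∈ P.region ↔ y ∈ P.region) := fun x hx y hy a b =>
    P.tameFor_region.mem_iff ⟨h₁ _ _ hx.1 hy.1 a, h₂ _ _ hx.2 hy.2 b⟩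
  have cell' : ∀ x ∈ U, ∀ y ∈ U, x ∉ P.region → SameSide {p.1} x.1 y.1 → SameSide {p.2} x.2 y.2 →
      y ∉ P.region := fun x hx y hy hxP a b h => hxP ((cell x hx y hy a b).2 h)
  -- two adjacent quadrants outside the polygon
  have adj : ∀ x ∈ U, ∀ y ∈ U, x ∉ P.region → y ∉ P.region → x.1 ≠ p.1 → x.2 ≠ p.2 →
      y.1 ≠ p.1 → y.2 ≠ p.2 → (SameSide {p.1} x.1 y.1 ∨ SameSide {p.2} x.2 y.2) → w x = w y := by
    intro x hxU y hyU hx hy hx₁ hx₂ hy₁ hy₂ hxy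
    refine eq_of_isPreconnected hw (convex_segment x y).isPreconnected (fun z hz hzP => ?_)
      (left_mem_segment ℝ x y) (right_mem_segment ℝ x y)
    have hzU := hUc.segment_subset hxU hyU hz
    have hz' := Prod.segment_subset _ _ hz
    rw [segment_eq_uIcc, segment_eq_uIcc] at hz'
    -- The region is the closure of its interior, so near `z` it has points off both axes.
    have hgen : ∀ V : Set Pt, IsOpen V → z ∈ V →
        ∃ g ∈ U, g ∈ V ∧ g ∈ P.region ∧ g.1 ≠ p.1 ∧ g.2 ≠ p.2 := by
      intro V hV hzV
      have hzc : z ∈ closure (interior P.region) := P.closure_interior.symm ▸ hzP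
      have hne := mem_closure_iff.1 hzc _ (hUo.inter hV) ⟨hzU, hzV⟩
      obtain ⟨g, ⟨⟨hgU, hgV⟩, hgP⟩, hg₁, hg₂⟩ :=
        exists_generic ((hUo.inter hV).inter isOpen_interior) hne p
      exact ⟨g, hgU, hgV, interior_subset hgP, hg₁, hg₂⟩
    rcases hxy with hxy | hxy
    · obtain ⟨g, hgU, hgV, hgP, -, hg₂⟩ := hgen {q | 0 < (x.1 - p.1) * (q.1 - p.1)}
        (isOpen_lt continuous_const (by fun_prop)) ((hxy.of_mem_uIcc hz'.1).mul_pos hx₁)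
      have hxg := sameSide_singleton hgV
      -- Of three nonzero offsets two have the same sign: either `z` shares the cell of `x`, or the
      -- region point `g` shares a quadrant with `x` or `y`.
      rcases sameSide_cases hx₂ hy₂ hg₂ with h | h | h
      · exact cell' x hxU z hzU hx (hxy.of_mem_uIcc hz'.1) (h.of_mem_uIcc hz'.2) hzP
      · exact cell' x hxU g hgU hx hxg h hgP
      · exact cell' y hyU g hgU hy (hxy.symm.trans hxg) h hgP
    · obtain ⟨g, hgU, hgV, hgP, hg₁, -⟩ := hgen {q | 0 < (x.2 - p.2) * (q.2 - p.2)}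
        (isOpen_lt continuous_const (by fun_prop)) ((hxy.of_mem_uIcc hz'.2).mul_pos hx₂)
      have hxg := sameSide_singleton hgV
      rcases sameSide_cases hx₁ hy₁ hg₁ with h | h | h
      · exact cell' x hxU z hzU hx (h.of_mem_uIcc hz'.1) (hxy.of_mem_uIcc hz'.2) hzP
      · exact cell' x hxU g hgU hx h hxg hgP
      · exact cell' y hyU g hgU hy h (hxy.symm.trans hxg) hgP
  have shrink : ∀ a b ε t : ℝ, |b - a| < ε → t ∈ Ioc (0 : ℝ) 1 → |a + t * (b - a) - a| < ε := by
    intro a b ε t h ht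
    rw [add_sub_cancel_left, abs_mul, abs_of_pos ht.1]
    exact (mul_le_of_le_one_left (abs_nonneg _) ht.2).trans_lt h
  have same : ∀ a b t : ℝ, b ≠ a → t ∈ Ioc (0 : ℝ) 1 → SameSide {a} b (a + t * (b - a)) := by
    intro a b t h ht
    refine sameSide_singleton ?_
    have : 0 < (b - a) ^ 2 := sq_pos_of_ne_zero (sub_ne_zero.2 h)
    nlinarith [_root_.mul_pos ht.1 this]
  -- boundary points between adjacent quadrants
  have ray₁ : ∀ u ∈ U, ∀ v ∈ U, u ∉ P.region → v ∈ P.region → u.2 ≠ p.2 → v.2 ≠ p.2 →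
      SameSide {p.1} u.1 v.1 → ∀ δ, |δ| < ε₁ → SameSide {p.1} u.1 (p.1 + δ) →
      p + ((δ, 0) : Pt) ∈ frontier P.region := by
    intro u huU v hvU hu hv hu₂ hv₂ huv δ hδ huδ
    rw [frontier_eq_closure_inter_closure]
    constructor
    · refine mem_closure_of_ray (v := (0, v.2 - p.2)) fun t ht => ?_
      refine (cell v hvU _ ⟨by simpa using hδ, ?_⟩ ?_ ?_).1 hv
      · simpa using shrink p.2 v.2 ε₂ t hvU.2 ht
      · simpa using huv.symm.trans huδ
      · simpa using same p.2 v.2 t hv₂ ht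
    · refine mem_closure_of_ray (v := (0, u.2 - p.2)) fun t ht => ?_
      refine cell' u huU _ ⟨by simpa using hδ, ?_⟩ hu ?_ ?_
      · simpa using shrink p.2 u.2 ε₂ t huU.2 ht
      · simpa using huδ
      · simpa using same p.2 u.2 t hu₂ ht
  have ray₂ : ∀ u ∈ U, ∀ v ∈ U, u ∉ P.region → v ∈ P.region → u.1 ≠ p.1 → v.1 ≠ p.1 →
      SameSide {p.2} u.2 v.2 → ∀ δ, |δ| < ε₂ → SameSide {p.2} u.2 (p.2 + δ) →
      p + ((0, δ) : Pt) ∈ frontier P.region := by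
    intro u huU v hvU hu hv hu₁ hv₁ huv δ hδ huδ
    rw [frontier_eq_closure_inter_closure]
    constructor
    · refine mem_closure_of_ray (v := (v.1 - p.1, 0)) fun t ht => ?_
      refine (cell v hvU _ ⟨?_, by simpa using hδ⟩ ?_ ?_).1 hv
      · simpa using shrink p.1 v.1 ε₁ t hvU.1 ht
      · simpa using same p.1 v.1 t hv₁ ht
      · simpa using huv.symm.trans huδ
    · refine mem_closure_of_ray (v := (u.1 - p.1, 0)) fun t ht => ?_
      refine cell' u huU _ ⟨?_, by simpa using hδ⟩ hu ?_ ?_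
      · simpa using shrink p.1 u.1 ε₁ t huU.1 ht
      · simpa using same p.1 u.1 t hu₁ ht
      · simpa using huδ
  have gen : ∀ x ∈ U, ∀ y ∈ U, x ∉ P.region → y ∉ P.region → x.1 ≠ p.1 → x.2 ≠ p.2 →
      y.1 ≠ p.1 → y.2 ≠ p.2 → w x = w y := by
    intro x hxU y hyU hx hy hx₁ hx₂ hy₁ hy₂
    by_cases h : SameSide {p.1} x.1 y.1 ∨ SameSide {p.2} x.2 y.2
    · exact adj x hxU y hyU hx hy hx₁ hx₂ hy₁ hy₂ h
    have hmU : ((x.1, y.2) : Pt) ∈ U := ⟨hxU.1, hyU.2⟩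
    have hmU' : ((y.1, x.2) : Pt) ∈ U := ⟨hyU.1, hxU.2⟩
    -- Opposite quadrants are linked through one of the other two if that one is outside. If neither
    -- is, the region looks like a checkerboard at `p` and the boundary leaves `p` in three
    -- directions.
    by_cases hm : ((x.1, y.2) : Pt) ∈ P.region
    · by_cases hm' : ((y.1, x.2) : Pt) ∈ P.region
      · exfalso
        push Not at h
        have hIoc : ∀ᶠ t in 𝓝[>] (0 : ℝ), t ∈ Ioc (0 : ℝ) 1 := Ioc_mem_nhdsGT (zero_lt_one' ℝ)
        refine not_three_germs (P := P) (c := p) (d := (x.1 - p.1, 0)) (e := (0, x.2 - p.2))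
          (sub_ne_zero.2 hx₁) (sub_ne_zero.2 hx₂) (hIoc.mono fun t ht => ?_).frequently
          (hIoc.mono fun t ht => ?_).frequently (hIoc.mono fun t ht => ?_).frequently
        · have := ray₁ x hxU _ hmU hx hm hx₂ hy₂ (.refl _ _) (t * (x.1 - p.1))
            (by simpa using shrink p.1 x.1 ε₁ t hxU.1 ht) (same _ _ _ hx₁ ht)
          simpa using this
        · have hs := shrink p.1 x.1 ε₁ t hxU.1 ht
          have := ray₁ y hyU _ hmU' hy hm' hy₂ hx₂ (.refl _ _) (-(t * (x.1 - p.1)))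
            (by simpa using hs) ?_
          · simpa only [smul_neg, Prod.smul_mk, smul_eq_mul, mul_zero, Prod.neg_mk, neg_zero,
              mul_neg]
              using this
          · have hne : p.1 + -(t * (x.1 - p.1)) ≠ p.1 := by
              simpa [ht.1.ne', sub_eq_zero] using hx₁
            rcases sameSide_cases hx₁ hy₁ hne with h' | h' | h'
            · exact absurd h' h.1
            · have h₀ := h'.mul_pos hx₁
              have : 0 < (x.1 - p.1) ^ 2 := sq_pos_of_ne_zero (sub_ne_zero.2 hx₁)
              nlinarith [_root_.mul_pos ht.1 this]
            · exact h'
        · have := ray₂ x hxU _ hmU' hx hm' hx₁ hy₁ (.refl _ _) (t * (x.2 - p.2))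
            (by simpa using shrink p.2 x.2 ε₂ t hxU.2 ht) (same _ _ _ hx₂ ht)
          simpa using this
      · exact (adj x hxU _ hmU' hx hm' hx₁ hx₂ hy₁ hx₂ (.inr (.refl _ _))).trans
          (adj _ hmU' y hyU hm' hy hy₁ hx₂ hy₁ hy₂ (.inl (.refl _ _)))
    · exact (adj x hxU _ hmU hx hm hx₁ hx₂ hx₁ hy₂ (.inl (.refl _ _))).trans
        (adj _ hmU y hyU hm hy hx₁ hy₂ hy₁ hy₂ (.inr (.refl _ _)))
  have togen : ∀ x ∈ U, x ∉ P.region →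
      ∃ y ∈ U, y ∉ P.region ∧ y.1 ≠ p.1 ∧ y.2 ≠ p.2 ∧ w y = w x := by
    intro x hxU hx
    obtain ⟨V, hV, hVo, hxV⟩ := eventually_nhds_iff.1 (hw x hx)
    obtain ⟨y, ⟨⟨hyU, hy⟩, hyV⟩, hy₁, hy₂⟩ := exists_generic
      ((hUo.inter P.isClosed_region.isOpen_compl).inter hVo) ⟨x, ⟨hxU, hx⟩, hxV⟩ p
    exact ⟨y, hyU, hy, hy₁, hy₂, hV y hyV⟩
  have hpc : p ∈ closure P.regionᶜ := (frontier_eq_closure_inter_closure (s := P.region) ▸ hp).2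
  obtain ⟨x, hxU, hx⟩ := mem_closure_iff.1 hpc U hUo hpU
  refine ⟨w x, ?_⟩
  filter_upwards [hUo.mem_nhds hpU] with q hq hqP
  obtain ⟨y, hyU, hy, hy₁, hy₂, hyw⟩ := togen q hq hqP
  obtain ⟨z, hzU, hz, hz₁, hz₂, hzw⟩ := togen x hxU hx
  rw [← hyw, ← hzw]
  exact gen y hyU z hzU hy hz hy₁ hy₂ hz₁ hz₂

/-- A locally constant function on the exterior has one value near the boundary. -/
theorem exists_const_near_frontier (hw : ∀ q ∉ P.region, ∀ᶠ r in 𝓝 q, w r = w q) :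
    ∃ c, ∀ p ∈ frontier P.region, ∀ᶠ q in 𝓝 p, q ∉ P.region → w q = c := by
  have huniq : ∀ p ∈ frontier P.region, ∀ a b, (∀ᶠ q in 𝓝 p, q ∉ P.region → w q = a) →
      (∀ᶠ q in 𝓝 p, q ∉ P.region → w q = b) → a = b := by
    intro p hp a b ha hb
    have hpc : p ∈ closure P.regionᶜ := (frontier_eq_closure_inter_closure (s := P.region) ▸ hp).2
    have := mem_closure_iff_frequently.1 hpc
    obtain ⟨q, h₁, h₂, h₃⟩ := (this.and_eventually (ha.and hb)).exists
    rw [← h₂ h₁, h₃ h₁]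
  have hne : P.vertex 0 ∈ frontier P.region := by
    rw [frontier_eq]
    exact mem_iUnion.2 ⟨0, left_mem_segment ℝ _ _⟩
  obtain ⟨c, hc⟩ := exists_eventually_const hw _ hne
  refine ⟨c, fun p hp => ?_⟩
  -- The exterior value at a boundary point is unique and is shared by nearby boundary points;
  -- connectedness of the boundary spreads it.
  refine (P.isPreconnected_frontier.induction₂' (fun x y => ∀ c,
    (∀ᶠ q in 𝓝 x, q ∉ P.region → w q = c) → (∀ᶠ q in 𝓝 y, q ∉ P.region → w q = c))
    (fun x hx => ?_) (fun _ _ _ _ _ _ h₁ h₂ c h => h₂ c (h₁ c h)) hne hp) c hc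
  obtain ⟨a, ha⟩ := exists_eventually_const hw x hx
  filter_upwards [mem_nhdsWithin_of_mem_nhds (eventually_eventually_nhds.2 ha), self_mem_nhdsWithin]
    with y hy hyf
  refine ⟨fun b hb => ?_, fun b hb => ?_⟩
  · rwa [huniq x hx b a hb ha]
  · rwa [huniq y hyf b a hb hy]

end OrthogonalPolygon
/-! ### Separation by chords -/

/-- A point of the plane as a complex number. -/
def toC (p : Pt) : ℂ := ⟨p.1, p.2⟩

@[fun_prop]
theorem continuous_toC : Continuous toC := Complex.equivRealProdCLM.symm.continuous

theorem toC_sub_ne_zero {p q : Pt} (h : p ≠ q) : toC p - toC q ≠ 0 := by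
  rw [sub_ne_zero]
  intro h'
  exact h (Prod.ext (congrArg Complex.re h') (congrArg Complex.im h'))

/-- A quotient `w` off the slit plane is a real number at most `0`; then `y - a = w (x - a)` places
`a` on the segment with weights `-w / (1 - w)` at `x` and `1 / (1 - w)` at `y`. -/
theorem div_mem_slitPlane {a x y : Pt} (h : a ∉ segment ℝ x y) :
    (toC y - toC a) / (toC x - toC a) ∈ Complex.slitPlane := by
  have hx : x ≠ a := by rintro rfl; exact h (left_mem_segment ℝ _ _)
  by_contra hw
  set w := (toC y - toC a) / (toC x - toC a) with hwdef
  rw [Complex.mem_slitPlane_iff, not_or, not_lt, not_not] at hw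
  have hyw : toC y - toC a = w * (toC x - toC a) := by
    rw [hwdef, div_mul_cancel₀ _ (toC_sub_ne_zero hx)]
  have h₁ := congrArg Complex.re hyw
  have h₂ := congrArg Complex.im hyw
  simp only [toC, Complex.sub_re, Complex.sub_im, Complex.mul_re, Complex.mul_im, hw.2] at h₁ h₂
  have hpos : 0 < 1 - w.re := by linarith [hw.1]
  refine h ⟨-w.re / (1 - w.re), 1 / (1 - w.re), div_nonneg (by linarith [hw.1]) hpos.le,
    by positivity, by field_simp; ring, ?_⟩
  ext
  · simp only [Prod.fst_add, Prod.smul_fst, smul_eq_mul]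
    field_simp
    linarith
  · simp only [Prod.snd_add, Prod.smul_snd, smul_eq_mul]
    field_simp
    linarith

theorem continuousOn_arg {X : Type*} [TopologicalSpace X] {f : X → ℂ} {s : Set X}
    (hf : ContinuousOn f s) (h : ∀ x ∈ s, f x ∈ Complex.slitPlane) :
    ContinuousOn (fun x => Complex.arg (f x)) s :=
  fun x hx => (Complex.continuousAt_arg (h x hx)).comp_continuousWithinAt (hf x hx)

theorem angle_coe_div {u v : ℂ} (hu : u ≠ 0) (hv : v ≠ 0) :
    (Complex.arg (u / v) : Real.Angle) = Complex.arg u - Complex.arg v :=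
  Complex.arg_div_coe_angle hu hv

theorem eq_of_angle_coe_eq {a b : ℝ} (h : (a : Real.Angle) = b) (h' : |a - b| < 2 * Real.pi) :
    a = b := by
  obtain ⟨k, hk⟩ := Real.Angle.angle_eq_iff_two_pi_dvd_sub.1 h
  rw [hk, abs_mul, abs_of_pos Real.two_pi_pos] at h'
  have : |(k : ℝ)| < 1 := by
    by_contra h''
    push Not at h''
    nlinarith [Real.two_pi_pos]
  have hk₀ : k = 0 := by
    rw [← Int.cast_abs] at this
    exact Int.abs_lt_one_iff.1 (by exact_mod_cast this)
  rw [hk₀, Int.cast_zero, mul_zero, sub_eq_zero] at hk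
  exact hk

/-- Real lifts of one angle differ by multiples of `2π`, so a continuous lift is locally constant.
-/
theorem eventually_eq_of_angle_coe {X : Type*} [TopologicalSpace X] {s : Set X} {f : X → ℝ}
    {θ : Real.Angle} (hf : ContinuousOn f s) (h : ∀ x ∈ s, (f x : Real.Angle) = θ) {x : X}
    (hx : x ∈ s) : ∀ᶠ y in 𝓝[s] x, f y = f x := by
  filter_upwards [(hf x hx).eventually (Metric.ball_mem_nhds (f x) Real.two_pi_pos),
    self_mem_nhdsWithin] with y hy hys
  exact eq_of_angle_coe_eq ((h y hys).trans (h x hx).symm) hy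

/-- A segment that does not cross `[a, b]` is seen from `a` and `b` under angles whose difference
is the change of the angle under which `[a, b]` is seen. -/
theorem arg_sub_arg_eq {a b x y : Pt} (h : Disjoint (segment ℝ x y) (segment ℝ a b)) :
    Complex.arg ((toC y - toC a) / (toC x - toC a)) -
      Complex.arg ((toC y - toC b) / (toC x - toC b)) =
    Complex.arg ((toC y - toC a) / (toC y - toC b)) -
      Complex.arg ((toC x - toC a) / (toC x - toC b)) := by
  set m : ℝ → Pt := fun t => x + t • (y - x) with hm
  have hmem : ∀ t ∈ Icc (0 : ℝ) 1, m t ∈ segment ℝ x y := by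
    intro t ht
    rw [segment_eq_image']
    exact mem_image_of_mem _ ht
  have hsub : ∀ t ∈ Icc (0 : ℝ) 1, segment ℝ x (m t) ⊆ segment ℝ x y := fun t ht =>
    (convex_segment x y).segment_subset (left_mem_segment ℝ x y) (hmem t ht)
  have hmc : Continuous fun t => toC (m t) := continuous_toC.comp (by fun_prop)
  have ha : ∀ t ∈ Icc (0 : ℝ) 1, m t ≠ a := fun t ht e =>
    disjoint_left.1 h (hmem t ht) (e ▸ left_mem_segment ℝ a b)
  have hb : ∀ t ∈ Icc (0 : ℝ) 1, m t ≠ b := fun t ht e =>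
    disjoint_left.1 h (hmem t ht) (e ▸ right_mem_segment ℝ a b)
  have hx₀ : m 0 = x := by simp [hm]
  have hy₁ : m 1 = y := by simp [hm]
  have hI₀ : (0 : ℝ) ∈ Icc (0 : ℝ) 1 := by simp
  have hI₁ : (1 : ℝ) ∈ Icc (0 : ℝ) 1 := by simp
  have hxa : x ≠ a := hx₀ ▸ ha 0 hI₀
  have hxb : x ≠ b := hx₀ ▸ hb 0 hI₀
  -- Modulo `2π` the value `D t` does not depend on `t`. All three arguments stay on the slit plane,
  -- so `D` is continuous and hence constant.
  set D : ℝ → ℝ := fun t => Complex.arg ((toC (m t) - toC a) / (toC x - toC a)) -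
      Complex.arg ((toC (m t) - toC b) / (toC x - toC b)) -
      Complex.arg ((toC (m t) - toC a) / (toC (m t) - toC b)) with hD
  have hDc : ContinuousOn D (Icc 0 1) := by
    refine ContinuousOn.sub (ContinuousOn.sub ?_ ?_) ?_
    · refine continuousOn_arg (by fun_prop) fun t ht => div_mem_slitPlane fun h' => ?_
      exact disjoint_left.1 h (hsub t ht h') (left_mem_segment ℝ a b)
    · refine continuousOn_arg (by fun_prop) fun t ht => div_mem_slitPlane fun h' => ?_
      exact disjoint_left.1 h (hsub t ht h') (right_mem_segment ℝ a b)
    · refine continuousOn_arg (ContinuousOn.div (by fun_prop) (by fun_prop) fun t ht =>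
        toC_sub_ne_zero (hb t ht)) fun t ht => ?_
      rw [← neg_div_neg_eq, neg_sub, neg_sub]
      refine div_mem_slitPlane fun h' => disjoint_left.1 h (hmem t ht) ?_
      rwa [segment_symm]
  have hDθ : ∀ t ∈ Icc (0 : ℝ) 1,
      (D t : Real.Angle) = Complex.arg (toC x - toC b) - Complex.arg (toC x - toC a) := by
    intro t ht
    simp only [hD, Real.Angle.coe_sub]
    rw [angle_coe_div (toC_sub_ne_zero (ha t ht)) (toC_sub_ne_zero hxa),
      angle_coe_div (toC_sub_ne_zero (hb t ht)) (toC_sub_ne_zero hxb),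
      angle_coe_div (toC_sub_ne_zero (ha t ht)) (toC_sub_ne_zero (hb t ht))]
    abel
  have hconst : D 0 = D 1 := isPreconnected_Icc.induction₂' (fun s t => D s = D t)
    (fun t ht => (eventually_eq_of_angle_coe hDc hDθ ht).mono fun _ h => ⟨h.symm, h⟩)
    (fun _ _ _ _ _ _ h₁ h₂ => h₁.trans h₂) hI₀ hI₁
  simp only [hD, hx₀, hy₁] at hconst
  rw [div_self (toC_sub_ne_zero hxa), div_self (toC_sub_ne_zero hxb), Complex.arg_one] at hconst
  linarith

/-- `Θ q` is the total angle swept by the chain as seen from `q`. Each link adds a principal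
argument, continuous in `q` off `K` because the link stays in `K`. The differences between `a` and
`b` telescope since no link meets `[a, b]`. -/
theorem exists_angle_of_chain {K : Set Pt} {a b x y : Pt} (hx : x ∈ K)
    (h : Relation.ReflTransGen (fun u v => segment ℝ u v ⊆ K \ segment ℝ a b) x y) :
    y ∈ K ∧ ∃ Θ : Pt → ℝ, ContinuousOn Θ Kᶜ ∧
      (∀ q ∉ K, (Θ q : Real.Angle) = Complex.arg (toC y - toC q) - Complex.arg (toC x - toC q)) ∧
      Θ a - Θ b = Complex.arg ((toC y - toC a) / (toC y - toC b)) -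
        Complex.arg ((toC x - toC a) / (toC x - toC b)) := by
  induction h with
  | refl => exact ⟨hx, fun _ => 0, continuousOn_const, by simp, by simp⟩
  | @tail u v _ huv ih =>
    obtain ⟨hu, Θ, hc, hΘ, hab⟩ := ih
    have hv : v ∈ K := (huv (right_mem_segment ℝ u v)).1
    refine ⟨hv, fun q => Θ q + Complex.arg ((toC v - toC q) / (toC u - toC q)), ?_, ?_, ?_⟩
    · refine hc.add (continuousOn_arg (ContinuousOn.div ?_ ?_ fun q hq =>
        toC_sub_ne_zero fun h => hq (h ▸ hu)) fun q hq =>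
        div_mem_slitPlane fun h => hq (huv h).1)
      · exact (continuous_const.sub continuous_toC).continuousOn
      · exact (continuous_const.sub continuous_toC).continuousOn
    · intro q hq
      rw [Real.Angle.coe_add, hΘ q hq, angle_coe_div (toC_sub_ne_zero (ne_of_mem_of_not_mem hv hq))
        (toC_sub_ne_zero (ne_of_mem_of_not_mem hu hq))]
      abel
    · have := arg_sub_arg_eq (a := a) (b := b) (x := u) (y := v)
        (disjoint_left.2 fun r hr => (huv hr).2)
      linarith

theorem arg_div_pos {u v : ℂ} (h : 0 < v.re * u.im - v.im * u.re) : 0 < Complex.arg (u / v) := by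
  have him : 0 < (u / v).im := by
    rw [Complex.div_im, ← sub_div]
    refine div_pos (by linarith) (Complex.normSq_pos.2 ?_)
    rintro rfl
    simp at h
  refine lt_of_le_of_ne (Complex.arg_nonneg_iff.2 him.le) fun h' => ?_
  exact him.ne (Complex.arg_eq_zero_iff.1 h'.symm).2.symm

theorem arg_div_neg {u v : ℂ} (h : v.re * u.im - v.im * u.re < 0) : Complex.arg (u / v) < 0 := by
  rw [Complex.arg_neg_iff, Complex.div_im, ← sub_div]
  refine div_neg_of_neg_of_pos (by linarith) (Complex.normSq_pos.2 ?_)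
  rintro rfl
  simp at h

namespace OrthogonalPolygon

variable {P : OrthogonalPolygon}

/-- Two points of a polygon on different sides of a chord `[a, b]` (extended to points `a` and `b`
slightly outside) that crosses the segment between them are not connected outside the chord. -/
theorem not_chain_of_crossing {a b x y p q : Pt} (hp : p ∈ frontier P.region)
    (hq : q ∈ frontier P.region) (hpa : ∀ t ∈ Ioc (0 : ℝ) 1, p + t • (a - p) ∉ P.region)
    (hqb : ∀ t ∈ Ioc (0 : ℝ) 1, q + t • (b - q) ∉ P.region) (hxy : segment ℝ x y ⊆ P.region)
    (h₁ : 0 < (y - b).1 * (y - a).2 - (y - b).2 * (y - a).1)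
    (h₂ : (x - b).1 * (x - a).2 - (x - b).2 * (x - a).1 < 0)
    (h₃ : 0 < (y - a).1 * (x - a).2 - (y - a).2 * (x - a).1)
    (h₄ : (y - b).1 * (x - b).2 - (y - b).2 * (x - b).1 < 0) :
    ¬ Relation.ReflTransGen (fun u v => segment ℝ u v ⊆ P.region \ segment ℝ a b) x y := by
  intro h
  have hx : x ∈ P.region := hxy (left_mem_segment ℝ x y)
  obtain ⟨hy, Θ, hc, hΘ, hab⟩ := exists_angle_of_chain hx h
  -- Up to the factor `2π`, this is the winding number about `q` of the chain closed by the segment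
  -- from `y` back to `x`.
  set w : Pt → ℝ := fun q => Θ q + Complex.arg ((toC x - toC q) / (toC y - toC q)) with hw
  have hwc : ContinuousOn w P.regionᶜ := by
    refine hc.add (continuousOn_arg (ContinuousOn.div ?_ ?_ fun q hq =>
        toC_sub_ne_zero fun h => hq (h ▸ hy)) fun q hq =>
        div_mem_slitPlane fun h => hq (hxy (segment_symm ℝ x y ▸ h)))
    · exact (continuous_const.sub continuous_toC).continuousOn
    · exact (continuous_const.sub continuous_toC).continuousOn
  have hwθ : ∀ q ∈ P.regionᶜ, (w q : Real.Angle) = 0 := by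
    intro q hq
    simp only [hw]
    rw [Real.Angle.coe_add, hΘ q hq, angle_coe_div (toC_sub_ne_zero (ne_of_mem_of_not_mem hx hq))
        (toC_sub_ne_zero (ne_of_mem_of_not_mem hy hq))]
    abel
  have hloc : ∀ q ∉ P.region, ∀ᶠ r in 𝓝 q, w r = w q := by
    intro q hq
    have := eventually_eq_of_angle_coe hwc hwθ (x := q) hq
    rwa [P.isClosed_region.isOpen_compl.nhdsWithin_eq hq] at this
  obtain ⟨c, hc⟩ := exists_const_near_frontier hloc
  have hval : ∀ p ∈ frontier P.region, ∀ a, (∀ t ∈ Ioc (0 : ℝ) 1, p + t • (a - p) ∉ P.region) →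
      w a = c := by
    intro p hp a hpa
    have hcont : Continuous fun t : ℝ => p + t • (a - p) := by fun_prop
    have hlim : Tendsto (fun t : ℝ => p + t • (a - p)) (𝓝[>] 0) (𝓝 p) := by
      simpa using (hcont.tendsto 0).mono_left nhdsWithin_le_nhds
    obtain ⟨t, ht, htc⟩ := ((show ∀ᶠ t in 𝓝[>] (0 : ℝ), t ∈ Ioc (0 : ℝ) 1 from
      Ioc_mem_nhdsGT (zero_lt_one' ℝ)).and (hlim.eventually (hc p hp))).exists
    rw [← htc (hpa t ht)]
    refine eq_of_isPreconnected hloc (C := (fun t : ℝ => p + t • (a - p)) '' Ioc 0 1)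
      (isPreconnected_Ioc.image _ hcont.continuousOn) ?_ ⟨1, by simp, by simp⟩ ⟨t, ht, rfl⟩
    rintro _ ⟨s, hs, rfl⟩
    exact hpa s hs
  have e : w a = w b := (hval p hp a hpa).trans (hval q hq b hqb).symm
  simp only [hw] at e
  -- All four angles contribute positively to `w a - w b`, contradicting `e`.
  have g₁ := arg_div_pos (u := toC y - toC a) (v := toC y - toC b) h₁
  have g₂ := arg_div_neg (u := toC x - toC a) (v := toC x - toC b) h₂
  have g₃ := arg_div_pos (u := toC x - toC a) (v := toC y - toC a) h₃
  have g₄ := arg_div_neg (u := toC x - toC b) (v := toC y - toC b) h₄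
  linarith

end OrthogonalPolygon
/-! ### Coordinates along and across a segment -/

namespace SlidingSegment

variable (s : SlidingSegment)

/-- The coordinate perpendicular to the direction of `s`. -/
def across (p : Pt) : ℝ := if s.horizontal then p.2 else p.1

/-- The point with given coordinates along and across `s`. -/
def ofCoords (u y : ℝ) : Pt := if s.horizontal then (u, y) else (y, u)

@[simp] theorem along_ofCoords (u y : ℝ) : s.along (s.ofCoords u y) = u := by
  unfold along ofCoords; split_ifs <;> rfl

@[simp] theorem across_ofCoords (u y : ℝ) : s.across (s.ofCoords u y) = y := by
  unfold across ofCoords; split_ifs <;> rfl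

@[simp] theorem ofCoords_along_across (p : Pt) : s.ofCoords (s.along p) (s.across p) = p := by
  unfold along across ofCoords; split_ifs <;> rfl

theorem point_eq (u : ℝ) : s.point u = s.ofCoords u s.level := rfl

@[fun_prop] theorem continuous_along : Continuous s.along := by
  unfold along; split_ifs <;> fun_prop

@[fun_prop] theorem continuous_across : Continuous s.across := by
  unfold across; split_ifs <;> fun_prop

@[fun_prop] theorem continuous_ofCoords {X : Type*} [TopologicalSpace X] {f g : X → ℝ}
    (hf : Continuous f) (hg : Continuous g) : Continuous fun x => s.ofCoords (f x) (g x) := by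
  unfold ofCoords; split_ifs <;> fun_prop

theorem along_lineMap (p q : Pt) (t : ℝ) :
    s.along (p + t • (q - p)) = s.along p + t * (s.along q - s.along p) := by
  unfold along; split_ifs <;> simp

theorem ofCoords_lineMap (a b y z t : ℝ) :
    s.ofCoords a y + t • (s.ofCoords b z - s.ofCoords a y) =
      s.ofCoords (a + t * (b - a)) (y + t * (z - y)) := by
  unfold ofCoords; split_ifs <;> simp

theorem sameCell_iff {F : Finset ℝ} {p q : Pt} : SameCell F p q ↔
    SameSide F (s.along p) (s.along q) ∧ SameSide F (s.across p) (s.across q) := by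
  unfold SameCell along across; split_ifs <;> simp [and_comm]

theorem segment_ofCoords_left (u y z : ℝ) :
    segment ℝ (s.ofCoords u y) (s.ofCoords u z) = s.ofCoords u '' uIcc y z := by
  rw [← segment_eq_uIcc]
  unfold ofCoords
  split_ifs
  · exact (Prod.image_mk_segment_right ..).symm
  · exact (Prod.image_mk_segment_left ..).symm

theorem segment_ofCoords_right (u v y : ℝ) :
    segment ℝ (s.ofCoords u y) (s.ofCoords v y) = (fun x => s.ofCoords x y) '' uIcc u v := by
  rw [← segment_eq_uIcc]
  unfold ofCoords
  split_ifs
  · exact (Prod.image_mk_segment_left ..).symm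
  · exact (Prod.image_mk_segment_right ..).symm

end SlidingSegment

/-! ### Visibility -/

variable {P : OrthogonalPolygon} {s : SlidingSegment}

/-- The points that are visible from their orthogonal projection to the line of `s`. -/
def seen (P : OrthogonalPolygon) (s : SlidingSegment) : Set Pt :=
  {p | segment ℝ p (s.point (s.along p)) ⊆ P.region}

theorem ofCoords_mem_seen {u y : ℝ} :
    s.ofCoords u y ∈ seen P s ↔ ∀ z ∈ uIcc y s.level, s.ofCoords u z ∈ P.region := by
  simp only [seen, mem_ofPred_eq, s.along_ofCoords, s.point_eq, s.segment_ofCoords_left,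
    image_subset_iff]
  rfl

theorem mem_seen {p : Pt} :
    p ∈ seen P s ↔ ∀ z ∈ uIcc (s.across p) s.level, s.ofCoords (s.along p) z ∈ P.region := by
  rw [← ofCoords_mem_seen, s.ofCoords_along_across]

theorem mem_sight {u : ℝ} {p : Pt} : p ∈ sight P s u ↔ p ∈ seen P s ∧ s.along p = u := by
  unfold sight seen
  constructor
  · rintro ⟨rfl, h⟩
    exact ⟨h, rfl⟩
  · rintro ⟨h, rfl⟩
    exact ⟨rfl, h⟩

theorem mem_biUnion_sight {I : Set ℝ} {p : Pt} :
    p ∈ ⋃ u ∈ I, sight P s u ↔ p ∈ seen P s ∧ s.along p ∈ I := by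
  simp only [mem_iUnion, mem_sight, exists_prop]
  grind

theorem mem_visibility {p : Pt} :
    p ∈ visibility P s ↔ p ∈ seen P s ∧ s.along p ∈ Icc s.lo s.hi := mem_biUnion_sight

theorem seen_subset : seen P s ⊆ P.region := fun p h => h (left_mem_segment ℝ p _)

theorem sight_subset_visibility {u : ℝ} (hu : u ∈ Icc s.lo s.hi) :
    sight P s u ⊆ visibility P s := fun p hp => by
  rw [mem_sight] at hp
  rw [mem_visibility, hp.2]
  exact ⟨hp.1, hu⟩

theorem isClosed_seen : IsClosed (seen P s) := by
  have : seen P s = ⋂ t ∈ Icc (0 : ℝ) 1,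
      (fun p => p + t • (s.ofCoords (s.along p) s.level - p)) ⁻¹' P.region := by
    ext p
    simp only [seen, segment_eq_image', s.point_eq, mem_ofPred_eq, image_subset_iff, mem_iInter,
      mem_preimage]
    rfl
  rw [this]
  exact isClosed_biInter fun t _ => P.isClosed_region.preimage (by fun_prop)

theorem isClosed_sight (u : ℝ) : IsClosed (sight P s u) := by
  have : sight P s u = seen P s ∩ s.along ⁻¹' {u} := by
    ext p
    exact mem_sight
  rw [this]
  exact isClosed_seen.inter (isClosed_singleton.preimage s.continuous_along)

theorem tameFor_seen : TameFor P.coords (seen P s) := by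
  intro p q hpq hp
  rw [mem_seen] at hp ⊢
  intro z hz
  have hpq' := s.sameCell_iff.1 hpq
  -- The perpendicular from `q` is covered by a part up to the height of `p`, which stays in the
  -- common cell, and a part whose points share cells with the perpendicular from `p`.
  rcases uIcc_subset_uIcc_union_uIcc (b := s.across p) hz with h | h
  · refine P.tameFor_region p _ (s.sameCell_iff.2 ⟨?_, ?_⟩)
      (by simpa using hp (s.across p) left_mem_uIcc)
    · simpa using hpq'.1
    · simpa using hpq'.2.trans (hpq'.2.symm.of_mem_uIcc h)
  · refine P.tameFor_region _ _ (s.sameCell_iff.2 ⟨?_, ?_⟩) (hp z h)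
    · simpa using hpq'.1
    · simpa using SameSide.refl _ z

theorem tame_seen : Tame (seen P s) := ⟨_, tameFor_seen⟩

theorem tame_along_uIcc (s : SlidingSegment) (a b : ℝ) : Tame {p | s.along p ∈ uIcc a b} := by
  refine ⟨{a, b}, fun p q hpq hp => ?_⟩
  have h := (s.sameCell_iff.1 hpq).1
  have ha := h a (by simp)
  have hb := h b (by simp)
  simp only [mem_ofPred_eq, mem_uIcc] at hp ⊢
  grind

theorem tame_sweep (a b : ℝ) : Tame (⋃ v ∈ uIcc a b, sight P s v) :=
  tame_seen.of_boolean (tame_along_uIcc s a b) (fun x y => x ∧ y) fun _ => mem_biUnion_sight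

theorem tame_sight (u : ℝ) : Tame (sight P s u) := by
  simpa using tame_sweep (P := P) (s := s) u u

theorem point_mem_region (hs : s.carrier ⊆ P.region) {u : ℝ} (hu : u ∈ Icc s.lo s.hi) :
    s.ofCoords u s.level ∈ P.region := hs ⟨u, hu, rfl⟩

/-! ### Lines of sight separate -/

/-- The end, in the direction given by `σ`, of the line of sight at a position of `s`. -/
theorem exists_sight_end {u : ℝ} (hu : s.ofCoords u s.level ∈ P.region) {σ : ℝ} (hσ : σ ≠ 0) :
    ∃ r ≥ (0 : ℝ), (∀ r' ∈ Icc 0 r, s.ofCoords u (s.level + r' * σ) ∈ P.region) ∧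
      ∃ η > (0 : ℝ), ∀ t ∈ Ioc (0 : ℝ) 1, s.ofCoords u (s.level + (r + t * η) * σ) ∉ P.region := by
  set f : ℝ → Pt := fun r => s.ofCoords u (s.level + r * σ) with hf
  have hfc : Continuous f := by fun_prop
  set T : Set ℝ := {r | 0 ≤ r ∧ ∀ r' ∈ Icc 0 r, f r' ∈ P.region} with hT
  have hT₀ : (0 : ℝ) ∈ T := by
    refine ⟨le_rfl, fun r' hr' => ?_⟩
    rw [Icc_self, mem_singleton_iff] at hr'
    simpa [hf, hr'] using hu
  have hbdd : BddAbove T := by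
    obtain ⟨C, hC⟩ := (P.isCompact_region.image s.continuous_across).isBounded.subset_closedBall 0
    refine ⟨(C + |s.level|) / |σ|, fun r hr => ?_⟩
    have := hC (mem_image_of_mem _ (hr.2 r ⟨hr.1, le_rfl⟩))
    rw [mem_closedBall_zero_iff, Real.norm_eq_abs] at this
    simp only [hf, s.across_ofCoords] at this
    rw [le_div_iff₀ (abs_pos.2 hσ)]
    calc r * |σ| = |r * σ| := by rw [abs_mul, abs_of_nonneg hr.1]
      _ = |(s.level + r * σ) - s.level| := by rw [add_sub_cancel_left]
      _ ≤ |s.level + r * σ| + |s.level| := abs_sub _ _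
      _ ≤ _ := by gcongr
  set r := sSup T with hr
  have hr₀ : 0 ≤ r := le_csSup hbdd hT₀
  have hlt : ∀ r' ∈ Ico 0 r, f r' ∈ P.region := by
    intro r' hr'
    obtain ⟨x, hx, hx'⟩ := exists_lt_of_lt_csSup ⟨0, hT₀⟩ hr'.2
    exact hx.2 r' ⟨hr'.1, hx'.le⟩
  have hrmem : f r ∈ P.region := by
    rcases hr₀.eq_or_lt with h | h
    · rw [← h]
      exact hT₀.2 0 (by simp)
    · have : r ∈ closure (Ico 0 r) := by
        rw [closure_Ico h.ne]
        exact right_mem_Icc.2 hr₀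
      exact (P.isClosed_region.preimage hfc).closure_subset_iff.2 hlt this
  have hle : ∀ r' ∈ Icc 0 r, f r' ∈ P.region := by
    intro r' hr'
    rcases hr'.2.eq_or_lt with h | h
    · rwa [h]
    · exact hlt r' ⟨hr'.1, h⟩
  refine ⟨r, hr₀, hle, ?_⟩
  -- By tameness membership is constant on a short ray beyond the end. If that ray were inside the
  -- region, `r` would not be the supremum.
  have hev := (hfc.tendsto r).eventually (P.tame_region.eventually_ray (f r))
  obtain ⟨ε, hε, hball⟩ := Metric.eventually_nhds_iff.1 hev
  have hray := @hball (r + ε / 2) (by simp [abs_of_pos hε, hε])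
  have hfray : ∀ t : ℝ, f r + t • (f (r + ε / 2) - f r) = f (r + t * (ε / 2)) := by
    intro t
    simp only [hf, s.ofCoords_lineMap]
    congr 1 <;> ring
  simp only [hfray] at hray
  refine ⟨ε / 2, by positivity, fun t ht hmem => ?_⟩
  have hmem' := (hray t ht).1 hmem
  have : r + ε / 2 ∈ T := by
    refine ⟨by positivity, fun r' hr' => ?_⟩
    rcases le_or_gt r' r with h | h
    · exact hle r' ⟨hr'.1, h⟩
    · have := (hray ((r' - r) / (ε / 2)) ⟨by apply div_pos <;> linarith, by
        rw [div_le_one (by positivity)]; linarith [hr'.2]⟩).2 hmem'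
      rwa [div_mul_cancel₀ _ (by positivity), add_sub_cancel] at this
  have := le_csSup hbdd this
  linarith

/-- Positions of `s` before and behind `u` are separated by the line of sight at `u`. -/
theorem not_chain_across_sight (hs : s.carrier ⊆ P.region) {u v w : ℝ} (hv : v ∈ Icc s.lo s.hi)
    (hw : w ∈ Icc s.lo s.hi) (hu : (v < u ∧ u < w) ∨ (w < u ∧ u < v)) :
    ¬ Relation.ReflTransGen (fun x y => segment ℝ x y ⊆ P.region \ sight P s u)
      (s.ofCoords v s.level) (s.ofCoords w s.level) := by
  intro h
  have huI : u ∈ Icc s.lo s.hi := by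
    rcases hu with hu | hu
    · exact ⟨hv.1.trans hu.1.le, hu.2.le.trans hw.2⟩
    · exact ⟨hw.1.trans hu.1.le, hu.2.le.trans hv.2⟩
  have hup := point_mem_region hs huI
  obtain ⟨r₁, h₁, hr₁, η₁, hη₁, ho₁⟩ := exists_sight_end hup (one_ne_zero)
  obtain ⟨r₂, h₂, hr₂, η₂, hη₂, ho₂⟩ := exists_sight_end hup (neg_ne_zero.2 one_ne_zero)
  simp only [mul_one, mul_neg] at hr₁ ho₁ hr₂ ho₂
  -- `α` and `β` prolong the line of sight into the exterior at both ends; `hsub` shows that this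
  -- adds no point of the region.
  set β := s.level + (r₁ + η₁) with hβ
  set α := s.level + -(r₂ + η₂) with hα
  have hβl : s.level < β := by linarith
  have hαl : α < s.level := by linarith
  have hsub : segment ℝ (s.ofCoords u α) (s.ofCoords u β) ∩ P.region ⊆ sight P s u := by
    rintro x ⟨hx, hxP⟩
    rw [s.segment_ofCoords_left] at hx
    obtain ⟨z, hz, rfl⟩ := hx
    rw [uIcc_of_le (hαl.trans hβl).le] at hz
    rw [mem_sight, ofCoords_mem_seen, s.along_ofCoords]
    refine ⟨fun y hy => ?_, rfl⟩
    have hz₁ : z ≤ s.level + r₁ := by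
      by_contra hlt
      push Not at hlt
      refine ho₁ ((z - s.level - r₁) / η₁) ⟨by apply div_pos <;> linarith, by
        rw [div_le_one hη₁]; linarith [hz.2]⟩ ?_
      rw [div_mul_cancel₀ _ hη₁.ne']
      convert hxP using 2
      ring
    have hz₂ : s.level - r₂ ≤ z := by
      by_contra hlt
      push Not at hlt
      refine ho₂ ((s.level - r₂ - z) / η₂) ⟨by apply div_pos <;> linarith, by
        rw [div_le_one hη₂]; linarith [hz.1]⟩ ?_
      rw [div_mul_cancel₀ _ hη₂.ne']
      convert hxP using 2
      ring
    rw [mem_uIcc] at hy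
    rcases le_total s.level y with h' | h'
    · have := hr₁ (y - s.level) ⟨by linarith, by rcases hy with hy | hy <;> linarith⟩
      rwa [add_sub_cancel] at this
    · have := hr₂ (s.level - y) ⟨by linarith, by rcases hy with hy | hy <;> linarith⟩
      rwa [neg_sub, add_sub_cancel] at this
  have hchain : Relation.ReflTransGen (fun x y => segment ℝ x y ⊆
      P.region \ segment ℝ (s.ofCoords u α) (s.ofCoords u β))
      (s.ofCoords v s.level) (s.ofCoords w s.level) := by
    exact Relation.ReflTransGen.mono (fun x y hxy z hz =>
      ⟨(hxy hz).1, fun hz' => (hxy hz).2 (hsub ⟨hz', (hxy hz).1⟩)⟩) _ _ h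
  have hseg : segment ℝ (s.ofCoords v s.level) (s.ofCoords w s.level) ⊆ P.region := by
    rw [s.segment_ofCoords_right]
    rintro _ ⟨z, hz, rfl⟩
    exact point_mem_region hs (ordConnected_Icc.uIcc_subset hv hw hz)
  have hfr : ∀ y e : ℝ, s.ofCoords u y ∈ P.region →
      (∀ t ∈ Ioc (0 : ℝ) 1, s.ofCoords u y + t • (s.ofCoords u e - s.ofCoords u y) ∉ P.region) →
      s.ofCoords u y ∈ frontier P.region := by
    intro y e hy h
    rw [frontier_eq_closure_inter_closure]
    exact ⟨subset_closure hy, mem_closure_of_ray h⟩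
  have hb : ∀ t ∈ Ioc (0 : ℝ) 1, s.ofCoords u (s.level + r₁) +
      t • (s.ofCoords u β - s.ofCoords u (s.level + r₁)) ∉ P.region := by
    intro t ht
    have := ho₁ t ht
    rwa [s.ofCoords_lineMap, show u + t * (u - u) = u by ring,
      show s.level + r₁ + t * (β - (s.level + r₁)) = s.level + (r₁ + t * η₁) by rw [hβ]; ring]
  have ha : ∀ t ∈ Ioc (0 : ℝ) 1, s.ofCoords u (s.level + -r₂) +
      t • (s.ofCoords u α - s.ofCoords u (s.level + -r₂)) ∉ P.region := by
    intro t ht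
    have := ho₂ t ht
    rwa [s.ofCoords_lineMap, show u + t * (u - u) = u by ring,
      show s.level + -r₂ + t * (α - (s.level + -r₂)) = s.level + -(r₂ + t * η₂) by rw [hα]; ring]
  have hfa := hfr _ _ (hr₂ r₂ ⟨h₂, le_rfl⟩) ha
  have hfb := hfr _ _ (hr₁ r₁ ⟨h₁, le_rfl⟩) hb
  -- The crossing lemma assumes an orientation, which depends on the axis of `s` and on the order of
  -- `v` and `w`; both orders of the ends are prepared.
  have key₁ := OrthogonalPolygon.not_chain_of_crossing hfa hfb ha hb hseg
  have key₂ := OrthogonalPolygon.not_chain_of_crossing hfb hfa hb ha hseg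
  rw [segment_symm] at key₂
  unfold SlidingSegment.ofCoords at key₁ key₂ hchain
  cases hh : s.horizontal <;> simp only [hh, if_true, if_false, Prod.fst_sub, Prod.snd_sub,
    Bool.false_eq_true] at key₁ key₂ hchain
  · rcases hu with hu | hu
    · refine key₂ ?_ ?_ ?_ ?_ hchain <;> nlinarith
    · refine key₁ ?_ ?_ ?_ ?_ hchain <;> nlinarith
  · rcases hu with hu | hu
    · refine key₁ ?_ ?_ ?_ ?_ hchain <;> nlinarith
    · refine key₂ ?_ ?_ ?_ ?_ hchain <;> nlinarith

/-! ### Visibility close to a line of sight -/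

variable {P : OrthogonalPolygon} {s : SlidingSegment}

theorem SlidingSegment.ofCoords_add_smul (s : SlidingSegment) (x y x' y' t : ℝ) :
    s.ofCoords x y + t • s.ofCoords x' y' = s.ofCoords (x + t * x') (y + t * y') := by
  unfold ofCoords; split_ifs <;> simp

theorem exists_isReflex_ofCoords {u y a b : ℝ} (ha : a ≠ 0) (hb : b ≠ 0)
    (h₁ : ∀ t ∈ Ioc (0 : ℝ) 1, s.ofCoords (u + t * a) y ∈ P.region)
    (h₂ : ∀ t ∈ Ioc (0 : ℝ) 1, s.ofCoords u (y + t * b) ∈ P.region)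
    (h₃ : ∀ t ∈ Ioc (0 : ℝ) 1, ∀ r ∈ Ioc (0 : ℝ) 1,
      s.ofCoords (u + t * a) (y + r * b) ∉ P.region) :
    ∃ j, P.IsReflex j ∧ P.vertex j = s.ofCoords u y := by
  cases hh : s.horizontal
  · refine OrthogonalPolygon.exists_isReflex (d := s.ofCoords 0 b) (e := s.ofCoords a 0) ?_ ?_
      ?_ ?_ ?_
    · simpa [SlidingSegment.ofCoords, hh] using hb
    · simpa [SlidingSegment.ofCoords, hh] using ha
    · simpa [s.ofCoords_add_smul] using h₂
    · simpa [s.ofCoords_add_smul] using h₁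
    · simpa [s.ofCoords_add_smul] using fun t ht ht' r hr hr' => h₃ r ⟨hr, hr'⟩ t ⟨ht, ht'⟩
  · refine OrthogonalPolygon.exists_isReflex (d := s.ofCoords a 0) (e := s.ofCoords 0 b) ?_ ?_
      ?_ ?_ ?_
    · simpa [SlidingSegment.ofCoords, hh] using ha
    · simpa [SlidingSegment.ofCoords, hh] using hb
    · simpa [s.ofCoords_add_smul] using h₁
    · simpa [s.ofCoords_add_smul] using h₂
    · simpa [s.ofCoords_add_smul] using fun t ht ht' r hr hr' => h₃ t ⟨ht, ht'⟩ r ⟨hr, hr'⟩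

/-- If no reflex vertex is seen from an interior position `u` of `s`, then the points of the
polygon close to a point that is seen from `u` are seen as well. -/
theorem eventually_mem_seen (hs : s.carrier ⊆ P.region) {u : ℝ} (hu : u ∈ Ioo s.lo s.hi)
    (hr : ∀ j, P.IsReflex j → P.vertex j ∉ sight P s u) {p : Pt} (hp : p ∈ sight P s u) :
    ∀ᶠ q in 𝓝[P.region] p, q ∈ seen P s := by
  obtain ⟨hps, rfl⟩ := mem_sight.1 hp
  have hpz := mem_seen.1 hps
  set u := s.along p
  set b := s.across p
  have ev₁ : ∀ᶠ q in 𝓝 p, s.along q ∈ Ioo s.lo s.hi :=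
    s.continuous_along.continuousAt.eventually (Ioo_mem_nhds hu.1 hu.2)
  have ev₂ : ∀ᶠ q in 𝓝 p, ∀ t ∈ Ioc (0 : ℝ) 1,
      SameSide P.coords (s.along q) (u + t * (s.along q - u)) :=
    s.continuous_along.continuousAt.eventually (SameSide.eventually P.coords u)
  have ev₃ : ∀ᶠ q in 𝓝 p, ∀ t ∈ Ioc (0 : ℝ) 1,
      SameSide P.coords (s.across q) (b + t * (s.across q - b)) :=
    s.continuous_across.continuousAt.eventually (SameSide.eventually P.coords b)
  filter_upwards [mem_nhdsWithin_of_mem_nhds ev₁, mem_nhdsWithin_of_mem_nhds ev₂,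
    mem_nhdsWithin_of_mem_nhds ev₃, P.tame_region.eventually_segment_subset (seen_subset hps),
    self_mem_nhdsWithin] with q hq₁ hq₂ hq₃ hqs hqP
  set a := s.along q
  set y := s.across q
  have hqay : q = s.ofCoords a y := (s.ofCoords_along_across q).symm
  by_contra hq
  rw [mem_seen] at hq
  push Not at hq
  obtain ⟨z, hz, hzP⟩ := hq
  change z ∈ uIcc y s.level at hz
  change s.ofCoords a z ∉ P.region at hzP
  have hcell : ∀ v v' y y' : ℝ, SameSide P.coords v v' → SameSide P.coords y y' →
      s.ofCoords v y ∈ P.region → s.ofCoords v' y' ∈ P.region := fun v v' y y' h h' =>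
    P.tameFor_region _ _ (s.sameCell_iff.2 ⟨by simpa using h, by simpa using h'⟩)
  by_cases hau : a = u
  · have hpb : p = s.ofCoords u b := (s.ofCoords_along_across p).symm
    rcases uIcc_subset_uIcc_union_uIcc (b := b) hz with h | h
    · apply hzP
      apply hqs
      rw [hqay, hpb, hau, s.segment_ofCoords_left]
      exact mem_image_of_mem _ (by rwa [uIcc_comm])
    · exact hzP (hau ▸ hpz z h)
  have hray : ∀ t ∈ Ioc (0 : ℝ) 1, s.ofCoords a (b + t * (y - b)) ∈ P.region := fun t ht =>
    hcell a a y _ (.refl _ _) (hq₃ t ht) (hqay ▸ hqP)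
  have hbP : s.ofCoords a b ∈ P.region := by
    refine P.isClosed_region.closure_subset_iff.2 subset_rfl
      (mem_closure_of_ray (v := s.ofCoords 0 (y - b)) fun t ht => ?_)
    rw [s.ofCoords_add_smul, mul_zero, add_zero]
    exact hray t ht
  have hlP : s.ofCoords a s.level ∈ P.region :=
    point_mem_region hs (Ioo_subset_Icc_self hq₁)
  -- Between the heights of `p` and `q` the perpendicular stays in the region, so the obstacle lies
  -- between `s` and the height of `p`.
  have hz' : z ∈ uIcc s.level b := by
    rcases uIcc_subset_uIcc_union_uIcc (b := b) hz with h | h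
    · exfalso
      rw [uIcc_comm, ← segment_eq_uIcc, segment_eq_image'] at h
      obtain ⟨t, ⟨h₀, h₁⟩, rfl⟩ := h
      rcases h₀.eq_or_lt with rfl | h₀
      · exact hzP (by simpa using hbP)
      · exact hzP (hray t ⟨h₀, h₁⟩)
    · rwa [uIcc_comm]
  rw [← segment_eq_uIcc, segment_eq_image'] at hz'
  obtain ⟨τ, ⟨hτ₀, hτ₁⟩, rfl⟩ := hz'
  simp only [smul_eq_mul] at hzP
  have hτ₁ : τ < 1 := by
    refine lt_of_le_of_ne hτ₁ ?_
    rintro rfl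
    exact hzP (by simpa using hbP)
  -- the last point of the polygon before the obstacle
  set G : Set ℝ := {t ∈ Icc 0 τ | s.ofCoords a (s.level + t * (b - s.level)) ∈ P.region} with hG
  have hGc : IsClosed G :=
    isClosed_Icc.inter (P.isClosed_region.preimage
      (f := fun t => s.ofCoords a (s.level + t * (b - s.level))) (by fun_prop))
  have hG₀ : (0 : ℝ) ∈ G := ⟨⟨le_rfl, hτ₀⟩, by simpa using hlP⟩
  have hGb : BddAbove G := ⟨τ, fun t ht => ht.1.2⟩
  have hm := hGc.csSup_mem ⟨0, hG₀⟩ hGb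
  set m := sSup G
  have hmτ : m < τ := by
    refine lt_of_le_of_ne hm.1.2 fun h => hzP ?_
    have := hm.2
    rwa [h] at this
  have hbl : b - s.level ≠ 0 := by
    intro h
    rw [h, mul_zero, add_zero] at hzP
    exact hzP hlP
  have hconv : ∀ t ∈ Ioc (0 : ℝ) 1, m + t * (τ - m) ∈ Icc (0 : ℝ) 1 := fun t ht =>
    ⟨by nlinarith [hm.1.1, ht.1], by nlinarith [ht.2]⟩
  have hseg : ∀ t ∈ Icc (0 : ℝ) 1, s.level + t * (b - s.level) ∈ uIcc b s.level := by
    intro t ht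
    rw [uIcc_comm, ← segment_eq_uIcc, segment_eq_image']
    exact ⟨t, ht, by simp⟩
  -- Project the last free point to the line of sight at `u`. The region extends from there towards
  -- `q` and along the line of sight, while the quadrant between is outside: a reflex vertex seen
  -- from `u`.
  obtain ⟨j, hj, hjc⟩ := exists_isReflex_ofCoords (P := P) (s := s) (u := u)
    (y := s.level + m * (b - s.level)) (a := a - u) (b := (τ - m) * (b - s.level))
    (sub_ne_zero.2 hau) (mul_ne_zero (sub_ne_zero.2 hmτ.ne') hbl)
    (fun t ht => hcell _ _ _ _ (hq₂ t ht) (.refl _ _) hm.2)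
    (fun t ht => by
      rw [show s.level + m * (b - s.level) + t * ((τ - m) * (b - s.level)) =
        s.level + (m + t * (τ - m)) * (b - s.level) by ring]
      exact hpz _ (hseg _ (hconv t ht)))
    (fun t ht r hr h => by
      rw [show s.level + m * (b - s.level) + r * ((τ - m) * (b - s.level)) =
        s.level + (m + r * (τ - m)) * (b - s.level) by ring] at h
      have h' := hcell _ _ _ _ (hq₂ t ht).symm (.refl _ _) h
      have : m + r * (τ - m) ∈ G := ⟨⟨(hconv r hr).1, by nlinarith [hr.2]⟩, h'⟩
      have := le_csSup hGb this
      nlinarith [mul_pos hr.1 (sub_pos.2 hmτ)])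
  refine hr j hj ?_
  rw [hjc, mem_sight, s.along_ofCoords, ofCoords_mem_seen]
  refine ⟨fun x hx => hpz x ?_, rfl⟩
  exact uIcc_subset_uIcc (hseg m ⟨hm.1.1, by linarith⟩) right_mem_uIcc hx

/-- A polygonal chain that avoids a line of sight avoids all lines of sight close to it. -/
theorem eventually_chain {x y : Pt} {u : ℝ}
    (h : Relation.ReflTransGen (fun x y => segment ℝ x y ⊆ P.region \ sight P s u) x y) :
    ∀ᶠ v in 𝓝 u, Relation.ReflTransGen
      (fun x y => segment ℝ x y ⊆ P.region \ sight P s v) x y := by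
  induction h with
  | refl => exact .of_forall fun _ => .refl
  | @tail y z _ hyz ih =>
    have hcl : IsClosed (s.along '' (segment ℝ y z ∩ seen P s)) :=
      (((isCompact_segment y z).inter_right isClosed_seen).image s.continuous_along).isClosed
    have hu : u ∉ s.along '' (segment ℝ y z ∩ seen P s) := by
      rintro ⟨q, ⟨hq, hqs⟩, hqu⟩
      exact (hyz hq).2 (mem_sight.2 ⟨hqs, hqu⟩)
    filter_upwards [ih, hcl.isOpen_compl.mem_nhds hu] with v hv hv'
    refine hv.tail fun q hq => ⟨(hyz hq).1, fun hqv => hv' ?_⟩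
    rw [mem_sight] at hqv
    exact ⟨q, ⟨hq, hqv.1⟩, hqv.2⟩

theorem segment_subset_seen {p : Pt} (hp : p ∈ seen P s) :
    segment ℝ p (s.ofCoords (s.along p) s.level) ⊆ seen P s ∩ {q | s.along q = s.along p} := by
  rw [mem_seen] at hp
  nth_rw 1 [← s.ofCoords_along_across p]
  rw [s.segment_ofCoords_left]
  rintro _ ⟨z, hz, rfl⟩
  refine ⟨ofCoords_mem_seen.2 fun x hx => hp x ?_, s.along_ofCoords _ _⟩
  exact uIcc_subset_uIcc hz right_mem_uIcc hx

theorem ahead_iff {d : Bool} {a b : ℝ} :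
    Ahead d a b ↔ 0 < (if d then (1 : ℝ) else -1) * (b - a) := by
  cases d <;> simp [Ahead]

/-- If the line of sight at `u` cuts off no piece of `A` that is not seen from `s`, and no position
behind `u` sees a part of `A`, then the part of `A` close to this line of sight is seen from `u` or
positions ahead of it. -/
theorem eventually_seen_ahead (hs : s.carrier ⊆ P.region) {u : ℝ} (hu : u ∈ Icc s.lo s.hi)
    {A : Set Pt} (hA : Tame A) (hAP : A ⊆ P.region) {d : Bool}
    (hbehind : ∀ v ∈ Icc s.lo s.hi, Ahead d v u → Disjoint A (sight P s v))
    (hpiece : ∀ W, IsPiece A (sight P s u) W → ¬ Disjoint W (visibility P s))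
    {p : Pt} (hp : p ∈ sight P s u) :
    ∀ᶠ q in 𝓝[P.region] p, q ∈ A → q ∈ seen P s ∧ ¬ Ahead d (s.along q) u := by
  obtain ⟨hps, hpu⟩ := mem_sight.1 hp
  filter_upwards [mem_nhdsWithin_of_mem_nhds ((tame_seen (P := P) (s := s)).eventually_ray p),
    P.tame_region.eventually_segment_subset (seen_subset hps)] with q hray hqs hqA
  by_contra hcon
  have hqu : q ∉ sight P s u := by
    intro h
    obtain ⟨h₁, h₂⟩ := mem_sight.1 h
    refine hcon ⟨h₁, ?_⟩
    simp [h₂, ahead_iff]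
  have hB : Tame (A \ sight P s u) := hA.diff (tame_sight u)
  -- The piece containing `q` has a point `y` seen from `s`, necessarily from a position `v`
  -- strictly ahead of `u`.
  obtain ⟨y, hyW, hyv⟩ := not_disjoint_iff.1 (hpiece _ ⟨q, ⟨hqA, hqu⟩, rfl⟩)
  obtain ⟨hyA, hyu⟩ := connectedComponentIn_subset _ _ hyW
  obtain ⟨hys, hyI⟩ := mem_visibility.1 hyv
  set v := s.along y
  have hvu : v ≠ u := fun h => hyu (mem_sight.2 ⟨hys, h⟩)
  have hvu' : ¬ Ahead d v u := fun h =>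
    disjoint_left.1 (hbehind v hyI h) hyA (mem_sight.2 ⟨hys, rfl⟩)
  have chain₁ : Relation.ReflTransGen (fun x y => segment ℝ x y ⊆ P.region \ sight P s u) q
      (s.ofCoords v s.level) := by
    refine (Relation.ReflTransGen.mono (fun _ _ h => h.trans (sdiff_subset_sdiff_left hAP)) _ _
      (hB.reflTransGen_of_mem_connectedComponentIn ⟨hqA, hqu⟩ hyW)).tail fun r hr => ?_
    obtain ⟨h₁, h₂⟩ := segment_subset_seen hys hr
    exact ⟨seen_subset h₁, fun h => hvu (h₂.symm.trans (mem_sight.1 h).2)⟩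
  -- Choose `x` strictly between `u` and `v`, so close to `u` that the chain still avoids the line
  -- of sight at `x`. Going from `s` at `u` through `p` and `q` and along the chain to `s` at `v`
  -- would bypass that line.
  have hlim : Tendsto (fun t : ℝ => u + t * (v - u)) (𝓝[>] 0) (𝓝 u) := by
    have : Continuous fun t : ℝ => u + t * (v - u) := by fun_prop
    simpa using (this.tendsto 0).mono_left nhdsWithin_le_nhds
  obtain ⟨t, ht, chain₂⟩ := ((show ∀ᶠ t in 𝓝[>] (0 : ℝ), t ∈ Ioo (0 : ℝ) 1 from
      Ioo_mem_nhdsGT (zero_lt_one' ℝ)).and (hlim.eventually (eventually_chain chain₁))).exists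
  set x := u + t * (v - u)
  have hxu : x - u = t * (v - u) := by simp [x]
  have hne : u ≠ x := by
    intro h
    rw [← h, sub_self, eq_comm, mul_eq_zero, sub_eq_zero] at hxu
    exact hxu.elim ht.1.ne' hvu
  have hside : (u < x ∧ x < v) ∨ (v < x ∧ x < u) := by
    rcases hvu.lt_or_gt with h | h
    · right
      constructor <;> nlinarith [ht.1, ht.2]
    · left
      constructor <;> nlinarith [ht.1, ht.2]
  have step₁ : segment ℝ (s.ofCoords u s.level) p ⊆ P.region \ sight P s x := by
    intro r hr
    rw [segment_symm, ← hpu] at hr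
    obtain ⟨h₁, h₂⟩ := segment_subset_seen hps hr
    refine ⟨seen_subset h₁, fun h => hne ?_⟩
    rw [← hpu, ← h₂, (mem_sight.1 h).2]
  have step₂ : segment ℝ p q ⊆ P.region \ sight P s x := by
    intro r hr
    refine ⟨hqs hr, fun h => ?_⟩
    obtain ⟨h₁, h₂⟩ := mem_sight.1 h
    rw [segment_eq_image'] at hr
    obtain ⟨τ, ⟨hτ₀, hτ₁⟩, rfl⟩ := hr
    rcases hτ₀.eq_or_lt with rfl | hτ₀
    · exact hne (by simpa [hpu] using h₂)
    -- If the short segment met the line of sight at `x`, then `q` would be seen by conicity, hence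
    -- be behind `u` by `hcon`; but `x` is ahead of `u`.
    · have hqs := (hray τ ⟨hτ₀, hτ₁⟩).1 h₁
      refine hcon ⟨hqs, fun hq => ?_⟩
      rw [s.along_lineMap, hpu] at h₂
      rw [ahead_iff] at hq hvu'
      set σ : ℝ := if d then 1 else -1
      have h₃ : τ * (s.along q - u) = t * (v - u) := by linarith
      have h₄ : σ * (τ * (s.along q - u)) = σ * (t * (v - u)) := by rw [h₃]
      nlinarith [mul_pos hτ₀ hq, mul_nonneg ht.1.le (sub_nonneg.2 (not_lt.1 hvu'))]
  exact not_chain_across_sight hs hu hyI hside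
    (Relation.ReflTransGen.head step₁ (.head step₂ chain₂))

/-- While a robot passes from `a` to `u`, the part of `A` that it has not seen is bounded by its
line of sight and by `L`. -/
theorem eventually_mem_diff_sweep (hs : s.carrier ⊆ P.region) {a u : ℝ} (ha : a ∈ Icc s.lo s.hi)
    (hu : u ∈ Icc s.lo s.hi) {d : Bool} (hau : Ahead d a u) {A L : Set Pt} (hA : Tame A)
    (hAP : A ⊆ P.region) (hAL : LocallyConstIn P.region (L ∪ sight P s a) A)
    (hbehind : ∀ v ∈ Icc s.lo s.hi, Ahead d v a → Disjoint A (sight P s v))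
    (hpiece : ∀ W, IsPiece A (sight P s a) W → ¬ Disjoint W (visibility P s))
    (hreflex : ∀ w, Ahead d a w → Ahead d w u → ∀ j, P.IsReflex j → P.vertex j ∉ sight P s w)
    {v : ℝ} (hv : v ∈ uIcc a u) {p : Pt} (hp : p ∈ P.region) (hpL : p ∉ L)
    (hpv : p ∉ sight P s v) :
    ∀ᶠ x in 𝓝 v ×ˢ 𝓝[P.region] p,
      (x.2 ∈ A \ ⋃ w ∈ uIcc a x.1, sight P s w ↔ p ∈ A \ ⋃ w ∈ uIcc a v, sight P s w) := by
  have hlim₁ : Tendsto (fun x : ℝ × Pt => x.1) (𝓝 v ×ˢ 𝓝[P.region] p) (𝓝 v) := tendsto_fst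
  have hlim₂ : Tendsto (fun x : ℝ × Pt => x.2) (𝓝 v ×ˢ 𝓝[P.region] p) (𝓝[P.region] p) :=
    tendsto_snd
  have hlim₃ : Tendsto (fun x : ℝ × Pt => s.along x.2) (𝓝 v ×ˢ 𝓝[P.region] p)
      (𝓝 (s.along p)) :=
    (s.continuous_along.tendsto p).comp (hlim₂.mono_right nhdsWithin_le_nhds)
  -- A swept `p` lies strictly behind the line of sight at `v`. Near it all of `A` has been swept:
  -- at the start `a` because no piece is hidden, at later positions because no reflex vertex is
  -- seen.
  by_cases hsw : p ∈ ⋃ w ∈ uIcc a v, sight P s w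
  · obtain ⟨hps, hpI⟩ := mem_biUnion_sight.1 hsw
    have hpne : s.along p ≠ v := fun h => hpv (mem_sight.2 ⟨hps, h⟩)
    have hpv' : Ahead d (s.along p) v := by
      rw [mem_uIcc] at hpI hv
      cases d <;> simp only [Ahead] at * <;> grind
    have hcore : ∀ᶠ q in 𝓝[P.region] p, q ∈ A → q ∈ seen P s ∧ ¬ Ahead d (s.along q) a := by
      by_cases hpa : s.along p = a
      · exact eventually_seen_ahead hs ha hA hAP hbehind hpiece (mem_sight.2 ⟨hps, hpa⟩)
      · have hap : Ahead d a (s.along p) := by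
          rw [mem_uIcc] at hpI hv
          cases d <;> simp only [Ahead] at * <;> grind
        have hpu : Ahead d (s.along p) u := by
          rw [mem_uIcc] at hpI hv
          cases d <;> simp only [Ahead] at * <;> grind
        have hI : s.along p ∈ Ioo s.lo s.hi := by
          cases d <;> simp only [Ahead] at hap hpu
          · exact ⟨hu.1.trans_lt hpu, hap.trans_le ha.2⟩
          · exact ⟨ha.1.trans_lt hap, hpu.trans_le hu.2⟩
        have hlim : ∀ᶠ q in 𝓝[P.region] p, Ahead d a (s.along q) := by
          refine mem_nhdsWithin_of_mem_nhds ?_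
          cases d
          · exact s.continuous_along.continuousAt.eventually (eventually_lt_nhds hap)
          · exact s.continuous_along.continuousAt.eventually (eventually_gt_nhds hap)
        filter_upwards [hlim, eventually_mem_seen hs hI (hreflex _ hap hpu)
          (mem_sight.2 ⟨hps, rfl⟩)] with q hq₁ hq₂ _
        refine ⟨hq₂, fun h => ?_⟩
        cases d <;> simp only [Ahead] at * <;> linarith
    have hahead : ∀ᶠ x in 𝓝 v ×ˢ 𝓝[P.region] p, Ahead d (s.along x.2) x.1 := by
      cases d
      · exact hlim₁.eventually_lt hlim₃ hpv'
      · exact hlim₃.eventually_lt hlim₁ hpv'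
    filter_upwards [hlim₂.eventually hcore, hahead] with x hx₁ hx₂
    refine iff_of_false (fun h => h.2 ?_) (fun h => h.2 hsw)
    obtain ⟨h₁, h₂⟩ := hx₁ h.1
    refine mem_biUnion_sight.2 ⟨h₁, ?_⟩
    rw [mem_uIcc]
    cases d <;> simp only [Ahead] at * <;> grind
  · have hpa : p ∉ L ∪ sight P s a := by
      rintro (h | h)
      · exact hpL h
      · exact hsw (mem_biUnion_sight.2 ⟨(mem_sight.1 h).1, (mem_sight.1 h).2 ▸ left_mem_uIcc⟩)
    -- Being swept is a closed condition on the pair of position and point, so it fails near an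
    -- unswept pair.
    have hev : ∀ᶠ x in 𝓝 v ×ˢ 𝓝[P.region] p, x.2 ∉ ⋃ w ∈ uIcc a x.1, sight P s w := by
      simp only [mem_biUnion_sight] at hsw ⊢
      by_cases hps : p ∈ seen P s
      · have hpI : s.along p < min a v ∨ max a v < s.along p := by
          by_contra h
          push Not at h
          exact hsw ⟨hps, h⟩
        rcases hpI with h | h
        · have hmin : Tendsto (fun x : ℝ × Pt => min a x.1) (𝓝 v ×ˢ 𝓝[P.region] p)
              (𝓝 (min a v)) := tendsto_const_nhds.min hlim₁
          filter_upwards [hlim₃.eventually_lt hmin h] with x hx hx'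
          exact absurd hx'.2.1 (not_le.2 hx)
        · have hmax : Tendsto (fun x : ℝ × Pt => max a x.1) (𝓝 v ×ˢ 𝓝[P.region] p)
              (𝓝 (max a v)) := tendsto_const_nhds.max hlim₁
          filter_upwards [hmax.eventually_lt hlim₃ h] with x hx hx'
          exact absurd hx'.2.2 (not_le.2 hx)
      · have := (isClosed_seen (P := P) (s := s)).isOpen_compl.mem_nhds hps
        filter_upwards [hlim₂.eventually (mem_nhdsWithin_of_mem_nhds this)] with x hx hx'
        exact hx hx'.1
    filter_upwards [hev, hlim₂.eventually (hAL p hp hpa)] with x hx₁ hx₂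
    simp only [Set.mem_sdiff, hx₁, hx₂, hsw]

/-! ### Invariants of the algorithm -/

section Invariants

variable {ι : Type} {P : OrthogonalPolygon} {s : ι → SlidingSegment}

/-- The lines of sight of the robots with tasks in the given list. -/
def linesOfSight (P : OrthogonalPolygon) (s : ι → SlidingSegment) (pos : ι → ℝ)
    (l : List (Task ι)) : Set Pt :=
  {p | ∃ σ ∈ l, p ∈ sight P (s σ.robot) (pos σ.robot)}

/-- The properties of a task `τ` on top of a stack `rest` that the algorithm maintains. -/
structure TaskInv (P : OrthogonalPolygon) (s : ι → SlidingSegment) (pos : ι → ℝ) (τ : Task ι)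
    (rest : List (Task ι)) : Prop where
  fresh : ∀ σ ∈ rest, σ.robot ≠ τ.robot
  todo_subset : τ.todo ⊆ τ.region
  region_subset : τ.region ⊆ P.region
  -- This guarantees that a robot seeing part of a hidden piece is not yet on the stack.
  unseen : ∀ σ ∈ rest, Disjoint τ.region (visibility P (s σ.robot))
  region_const : LocallyConstIn P.region (linesOfSight P s pos rest) τ.region
  todo_const : LocallyConstIn P.region
    (linesOfSight P s pos rest ∪ sight P (s τ.robot) (pos τ.robot)) τ.todo
  behind : ∀ v ∈ Icc (s τ.robot).lo (s τ.robot).hi, Ahead τ.direction v (pos τ.robot) →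
    Disjoint τ.todo (sight P (s τ.robot) v)
  tame_region : Tame τ.region
  tame_todo : Tame τ.todo

/-- The invariant of the stack of tasks. -/
def StackInv (P : OrthogonalPolygon) (s : ι → SlidingSegment) (pos : ι → ℝ) :
    List (Task ι) → Prop
  | [] => True
  | τ :: rest => TaskInv P s pos τ rest ∧ StackInv P s pos rest

/-- The invariant of the states. -/
def StateInv (P : OrthogonalPolygon) (s : ι → SlidingSegment) (x : State ι) : Prop :=
  (∀ k, x.pos k ∈ Icc (s k).lo (s k).hi) ∧ StackInv P s x.pos x.tasks

theorem linesOfSight_congr {pos pos' : ι → ℝ} {l : List (Task ι)}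
    (h : ∀ σ ∈ l, pos' σ.robot = pos σ.robot) :
    linesOfSight P s pos' l = linesOfSight P s pos l := by
  ext p
  refine exists_congr fun σ => and_congr_right fun hσ => ?_
  rw [h σ hσ]

theorem linesOfSight_cons (pos : ι → ℝ) (τ : Task ι) (l : List (Task ι)) :
    linesOfSight P s pos (τ :: l) =
      linesOfSight P s pos l ∪ sight P (s τ.robot) (pos τ.robot) := by
  ext p
  simp [linesOfSight, or_comm]

theorem TaskInv.congr {pos pos' : ι → ℝ} {τ : Task ι} {l : List (Task ι)}
    (h : TaskInv P s pos τ l) (hp : ∀ σ ∈ τ :: l, pos' σ.robot = pos σ.robot) :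
    TaskInv P s pos' τ l := by
  obtain ⟨h₁, h₂, h₃, h₄, h₅, h₆, h₇, h₈, h₉⟩ := h
  have hτ := hp τ List.mem_cons_self
  have hl := linesOfSight_congr (P := P) (s := s) fun σ hσ => hp σ (List.mem_cons_of_mem _ hσ)
  refine ⟨h₁, h₂, h₃, h₄, ?_, ?_, ?_, h₈, h₉⟩
  · rwa [hl]
  · rwa [hl, hτ]
  · rwa [hτ]

theorem StackInv.congr {pos pos' : ι → ℝ} {l : List (Task ι)} (h : StackInv P s pos l)
    (hp : ∀ σ ∈ l, pos' σ.robot = pos σ.robot) : StackInv P s pos' l := by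
  induction l with
  | nil => trivial
  | cons τ l ih =>
    exact ⟨h.1.congr hp, ih h.2 fun σ hσ => hp σ (List.mem_cons_of_mem _ hσ)⟩

theorem place_of_ne {pos : ι → ℝ} {i k : ι} {u : ℝ} (h : k ≠ i) : place pos i u k = pos k := by
  simp [place, h]

theorem place_self (pos : ι → ℝ) (i : ι) (u : ℝ) : place pos i u i = u := by
  simp [place]

theorem place_mem {pos : ι → ℝ} {i : ι} {u : ℝ} (h : ∀ k, pos k ∈ Icc (s k).lo (s k).hi)
    (hu : u ∈ Icc (s i).lo (s i).hi) (k : ι) : place pos i u k ∈ Icc (s k).lo (s k).hi := by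
  by_cases hk : k = i
  · subst hk
    rwa [place_self]
  · rw [place_of_ne hk]
    exact h k

theorem isPiece_subset {A ℓ W : Set Pt} (h : IsPiece A ℓ W) : W ⊆ A \ ℓ := by
  obtain ⟨p, -, rfl⟩ := h
  exact connectedComponentIn_subset _ _

theorem IsPiece.tame {A ℓ W : Set Pt} (h : IsPiece A ℓ W) (hA : Tame A) (hℓ : Tame ℓ) :
    Tame W := by
  obtain ⟨p, -, rfl⟩ := h
  exact (hA.diff hℓ).connectedComponentIn p

theorem start_inv {i : ι} {x : State ι} (hx : IsStart P s i x) : StateInv P s x := by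
  obtain ⟨h, d, hd, ht⟩ := hx
  refine ⟨h, ?_⟩
  rw [ht]
  refine ⟨⟨by simp, subset_rfl, subset_rfl, by simp, .refl _ _, .refl _ _, ?_, P.tame_region,
    P.tame_region⟩, trivial⟩
  intro v hv hvx
  simp only at hvx
  rw [hd] at hvx
  cases d
  · exact absurd hv.2 (not_le.2 hvx)
  · exact absurd hv.1 (not_le.2 hvx)

/-- Deleting the closed line of sight and passing to a component creates new boundary only along
that line. -/
theorem TaskInv.piece_const {pos : ι → ℝ} {τ : Task ι} {rest : List (Task ι)}
    (h : TaskInv P s pos τ rest) {W : Set Pt}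
    (hW : IsPiece τ.todo (sight P (s τ.robot) (pos τ.robot)) W) :
    LocallyConstIn P.region (linesOfSight P s pos (τ :: rest)) W := by
  obtain ⟨p, -, rfl⟩ := hW
  rw [linesOfSight_cons]
  exact (h.todo_const.diff
    (.of_isClosed (isClosed_sight _) subset_union_right)).connectedComponentIn P.tame_region p

/-- The hypotheses under which an active robot advances describe what it clears. -/
theorem TaskInv.eventually_advance (hs : ∀ k, (s k).carrier ⊆ P.region) {pos : ι → ℝ}
    {τ : Task ι} {rest : List (Task ι)} (h : TaskInv P s pos τ rest)
    (hpos : ∀ k, pos k ∈ Icc (s k).lo (s k).hi)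
    (hpiece : ∀ W, IsPiece τ.todo (sight P (s τ.robot) (pos τ.robot)) W →
      ¬ Disjoint W (visibility P (s τ.robot))) {u : ℝ} (hnext : IsNextEvent P s pos τ rest u)
    {v : ℝ} (hv : v ∈ uIcc (pos τ.robot) u) {p : Pt} (hp : p ∈ P.region)
    (hpL : p ∉ linesOfSight P s pos rest) (hpv : p ∉ sight P (s τ.robot) v) :
    ∀ᶠ x in 𝓝 v ×ˢ 𝓝[P.region] p,
      (x.2 ∈ τ.todo \ ⋃ w ∈ uIcc (pos τ.robot) x.1, sight P (s τ.robot) w ↔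
        p ∈ τ.todo \ ⋃ w ∈ uIcc (pos τ.robot) v, sight P (s τ.robot) w) :=
  eventually_mem_diff_sweep (hs τ.robot) (hpos τ.robot) hnext.1 hnext.2.1 h.tame_todo
    (h.todo_subset.trans h.region_subset) h.todo_const h.behind hpiece
    (fun w h₁ h₂ j hj hjw => hnext.2.2.2 w h₁ h₂ (.inl ⟨j, hj, hjw⟩)) hv hp hpL hpv

theorem Step.inv (hs : ∀ k, (s k).carrier ⊆ P.region) {x y : State ι} (hx : StateInv P s x)
    (h : Step P s x y) : StateInv P s y := by
  cases h with
  | signal pos τ rest W j d c piece unseen free sees mem before =>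
    obtain ⟨hpos, hτ, hrest⟩ := hx
    have hcongr : ∀ σ ∈ τ :: rest, place pos j c σ.robot = pos σ.robot := fun σ hσ =>
      place_of_ne (free σ hσ)
    refine ⟨place_mem hpos mem, ?_, hτ.congr hcongr, hrest.congr fun σ hσ =>
      hcongr σ (List.mem_cons_of_mem _ hσ)⟩
    have hWt : W ⊆ τ.todo := (isPiece_subset piece).trans sdiff_subset
    have hlc := hτ.piece_const piece
    rw [← linesOfSight_congr hcongr] at hlc
    have htame := piece.tame hτ.tame_todo (tame_sight _)
    refine ⟨free, subset_rfl, (hWt.trans hτ.todo_subset).trans hτ.region_subset, ?_, hlc,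
      hlc.mono subset_union_left, ?_, htame, htame⟩
    · intro σ hσ
      rcases List.mem_cons.1 hσ with rfl | hσ
      · exact unseen
      · exact (hτ.unseen σ hσ).mono_left (hWt.trans hτ.todo_subset)
    · intro v hv hvc
      simp only [place_self] at hvc
      exact before v hv hvc
  | advance pos τ rest u left noPiece next =>
    obtain ⟨hpos, hτ, hrest⟩ := hx
    have hcongr : ∀ σ ∈ rest, place pos τ.robot u σ.robot = pos σ.robot := fun σ hσ =>
      place_of_ne (hτ.fresh σ hσ)
    refine ⟨place_mem hpos next.1, ⟨hτ.fresh, sdiff_subset.trans hτ.todo_subset, hτ.region_subset,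
      hτ.unseen, ?_, ?_, ?_, hτ.tame_region, hτ.tame_todo.diff (tame_sweep _ _)⟩,
      hrest.congr hcongr⟩
    · rw [linesOfSight_congr hcongr]
      exact hτ.region_const
    · simp only
      rw [linesOfSight_congr hcongr, place_self]
      intro p hp hpL
      rw [mem_union, not_or] at hpL
      have := hτ.eventually_advance hs hpos noPiece next right_mem_uIcc hp hpL.1 hpL.2
      exact (tendsto_const_nhds.prodMk tendsto_id).eventually this
    · intro v hv hvu
      simp only [place_self] at hvu
      have hau := next.2.1
      by_cases hva : Ahead τ.direction v (pos τ.robot)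
      · exact (hτ.behind v hv hva).mono_left sdiff_subset
      · refine disjoint_left.2 fun p hp hpv => hp.2 ?_
        refine mem_biUnion_sight.2 ⟨(mem_sight.1 hpv).1, ?_⟩
        rw [(mem_sight.1 hpv).2, mem_uIcc]
        generalize τ.direction = d at *
        cases d <;> simp only [Ahead] at * <;> grind
  | finish pos τ σ rest b cleared mem back =>
    obtain ⟨hpos, hτ, hσ, hrest⟩ := hx
    have hcongr : ∀ ρ ∈ σ :: rest, place pos τ.robot b ρ.robot = pos ρ.robot := fun ρ hρ =>
      place_of_ne (hτ.fresh ρ hρ)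
    refine ⟨place_mem hpos mem, ?_, hrest.congr fun ρ hρ => hcongr ρ (List.mem_cons_of_mem _ hρ)⟩
    refine TaskInv.congr (pos := pos) ?_ (by
      intro ρ hρ
      rcases List.mem_cons.1 hρ with rfl | hρ
      · exact hcongr σ List.mem_cons_self
      · exact hcongr ρ (List.mem_cons_of_mem _ hρ))
    refine ⟨hσ.fresh, sdiff_subset.trans hσ.todo_subset, hσ.region_subset, hσ.unseen,
      hσ.region_const, ?_, fun v hv hvp => (hσ.behind v hv hvp).mono_left sdiff_subset,
      hσ.tame_region, hσ.tame_todo.diff hτ.tame_region⟩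
    -- The removed region is bounded by lines of sight of the waiting robots only, so the returning
    -- robot may move freely.
    have := hτ.region_const
    rw [linesOfSight_cons] at this
    exact hσ.todo_const.diff this
  | terminate pos τ b cleared mem back => exact ⟨place_mem hx.1 mem, trivial⟩

/-! ### The evader -/

/-- What the robots waiting for `W` and, successively, the regions of the robots above them have
left to clear outside these regions. -/
def waitingPart : Set Pt → List (Task ι) → Set Pt
  | _, [] => ∅
  | W, σ :: rest => (σ.todo \ W) ∪ waitingPart σ.region rest

/-- The set of points at which an unseen evader can be. -/
def contaminated : List (Task ι) → Set Pt
  | [] => ∅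
  | τ :: rest => τ.todo ∪ waitingPart τ.region rest

theorem StackInv.waitingPart_const {pos : ι → ℝ} {l : List (Task ι)} (h : StackInv P s pos l)
    {W : Set Pt} (hW : LocallyConstIn P.region (linesOfSight P s pos l) W) :
    LocallyConstIn P.region (linesOfSight P s pos l) (waitingPart W l) := by
  induction l generalizing W with
  | nil => exact .empty _ _
  | cons σ l ih =>
    have := h.1.todo_const
    rw [linesOfSight_cons] at hW ⊢
    exact (this.diff hW).union ((ih h.2 h.1.region_const).mono subset_union_left)

theorem StackInv.contaminated_const {pos : ι → ℝ} {l : List (Task ι)} (h : StackInv P s pos l) :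
    LocallyConstIn P.region (linesOfSight P s pos l) (contaminated l) := by
  cases l with
  | nil => exact .empty _ _
  | cons τ l =>
    rw [linesOfSight_cons]
    exact h.1.todo_const.union ((h.2.waitingPart_const h.1.region_const).mono subset_union_left)

/-- An evader that is not seen during a step stays in the contaminated region. -/
theorem Step.mem_contaminated (hs : ∀ k, (s k).carrier ⊆ P.region) {x y : State ι}
    (hx : StateInv P s x) (h : Step P s x y) {T : ℝ} (hT : 0 ≤ T) {m : ℝ → ι → ℝ}
    (hm : ∀ k, ContinuousOn (fun t => m t k) (Icc 0 T)) (hm₀ : m 0 = x.pos) (hmT : m T = y.pos)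
    (hmI : ∀ t ∈ Icc 0 T, ∀ k, m t k ∈ uIcc (x.pos k) (y.pos k)) {γ : ℝ → Pt}
    (hγ : ContinuousOn γ (Icc 0 T)) (hγP : MapsTo γ (Icc 0 T) P.region)
    (hun : ∀ t ∈ Icc 0 T, ∀ τ ∈ x.tasks, γ t ∉ sight P (s τ.robot) (m t τ.robot))
    (h₀ : γ 0 ∈ contaminated x.tasks) : γ T ∈ contaminated y.tasks := by
  have hstill : ∀ t ∈ Icc 0 T, ∀ k, y.pos k = x.pos k → m t k = x.pos k := by
    intro t ht k hk
    have := hmI t ht k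
    rwa [hk, uIcc_self, mem_singleton_iff] at this
  cases h with
  | signal pos τ rest W j d c piece unseen free sees mem before =>
    have hW : W ⊆ τ.todo := (isPiece_subset piece).trans sdiff_subset
    have := (hx.2.contaminated_const.mem_iff_of_curve hγ hγP (fun t ht => ?_) hT).1 h₀
    · change γ T ∈ τ.todo ∪ waitingPart τ.region rest at this
      change γ T ∈ W ∪ ((τ.todo \ W) ∪ waitingPart τ.region rest)
      rwa [← union_assoc, union_sdiff_cancel hW]
    · rintro ⟨σ, hσ, hσt⟩
      refine hun t ht σ hσ ?_
      rwa [hstill t ht _ (place_of_ne (free σ hσ))]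
  | advance pos τ rest u left noPiece next =>
    obtain ⟨hpos, hτ, hrest⟩ := hx
    have hL : ∀ t ∈ Icc 0 T, γ t ∉ linesOfSight P s pos rest := by
      rintro t ht ⟨σ, hσ, hσt⟩
      refine hun t ht σ (List.mem_cons_of_mem _ hσ) ?_
      rwa [hstill t ht _ (place_of_ne (hτ.fresh σ hσ))]
    rcases h₀ with h₀ | h₀
    · left
      -- Robot and evader move together: membership of the evader in the part not yet swept is
      -- locally constant in time.
      have key : ∀ t ∈ Icc 0 T, ∀ᶠ t' in 𝓝[Icc 0 T] t,
          (γ t' ∈ τ.todo \ ⋃ w ∈ uIcc (pos τ.robot) (m t' τ.robot), sight P (s τ.robot) w ↔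
            γ t ∈ τ.todo \ ⋃ w ∈ uIcc (pos τ.robot) (m t τ.robot), sight P (s τ.robot) w) := by
        intro t ht
        have hmt := hmI t ht τ.robot
        simp only [place_self] at hmt
        exact (Tendsto.prodMk (hm τ.robot t ht) ((hγ t ht).tendsto_nhdsWithin hγP)).eventually
          (hτ.eventually_advance hs hpos noPiece next hmt (hγP ht) (hL t ht)
            (hun t ht τ List.mem_cons_self))
      have := (mem_of_locally_const isPreconnected_Icc key (left_mem_Icc.2 hT)
        (right_mem_Icc.2 hT)).1 ⟨h₀, ?_⟩
      · rw [hmT] at this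
        simpa only [place_self] using this
      · rw [hm₀]
        have := hun 0 (left_mem_Icc.2 hT) τ List.mem_cons_self
        rw [hm₀] at this
        simpa using this
    · right
      exact ((hrest.waitingPart_const hτ.region_const).mem_iff_of_curve hγ hγP hL hT).1 h₀
  | finish pos τ σ rest b cleared mem back =>
    obtain ⟨hpos, hτ, hσrest⟩ := hx
    have hL : ∀ t ∈ Icc 0 T, γ t ∉ linesOfSight P s pos (σ :: rest) := by
      rintro t ht ⟨ρ, hρ, hρt⟩
      refine hun t ht ρ (List.mem_cons_of_mem _ hρ) ?_
      rwa [hstill t ht _ (place_of_ne (hτ.fresh ρ hρ))]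
    rcases h₀ with h₀ | h₀
    · have := hun 0 (left_mem_Icc.2 hT) τ List.mem_cons_self
      rw [hm₀] at this
      exact absurd (cleared h₀) this
    · exact ((hσrest.waitingPart_const hτ.region_const).mem_iff_of_curve hγ hγP hL hT).1 h₀
  | terminate pos τ b cleared mem back =>
    rcases h₀ with h₀ | h₀
    · have := hun 0 (left_mem_Icc.2 hT) τ List.mem_cons_self
      rw [hm₀] at this
      exact absurd (cleared h₀) this
    · exact h₀

end Invariants
/-! ### The motion of a run -/

section Runs

variable {ι : Type} {P : OrthogonalPolygon} {s : ι → SlidingSegment}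

theorem Run.pos_mem (hs : ∀ k, (s k).carrier ⊆ P.region) {x : State ι} {l : List (State ι)}
    (h : Run P s x l) (hx : StateInv P s x) :
    ∀ d ∈ l.map State.pos, ∀ k, d k ∈ Icc (s k).lo (s k).hi := by
  induction h with
  | done pos => simp
  | step x y l hxy _ ih =>
    have hy := hxy.inv hs hx
    rw [List.map_cons, List.forall_mem_cons]
    exact ⟨hy.1, ih hy⟩

variable [Fintype ι]

theorem follow_zero (c : ι → ℝ) (l : List (ι → ℝ)) : follow c l 0 = c := by
  cases l with
  | nil => rfl
  | cons d l => simp [follow]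

/-- For a leg of length zero the quotient is `0` by convention, which is harmless because the ends
coincide. -/
theorem lineMap_div_dist (c d : ι → ℝ) :
    AffineMap.lineMap c d (dist c d / dist c d) = d := by
  by_cases h : c = d
  · simp [h]
  · simp [div_self (dist_ne_zero.2 h)]

theorem follow_of_le {c d : ι → ℝ} {l : List (ι → ℝ)} {t : ℝ} (h : t ≤ dist c d) :
    follow c (d :: l) t = AffineMap.lineMap c d (t / dist c d) := by
  simp [follow, h]

theorem follow_of_ge {c d : ι → ℝ} {l : List (ι → ℝ)} {t : ℝ} (h : dist c d ≤ t) :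
    follow c (d :: l) t = follow d l (t - dist c d) := by
  rcases h.eq_or_lt with rfl | h
  · rw [follow_of_le le_rfl, lineMap_div_dist, sub_self, follow_zero]
  · simp [follow, h]

theorem continuous_follow (c : ι → ℝ) (l : List (ι → ℝ)) : Continuous (follow c l) := by
  induction l generalizing c with
  | nil => exact continuous_const
  | cons d l ih =>
    refine Continuous.if_le (f' := fun t : ℝ => AffineMap.lineMap c d (t / dist c d))
      (g' := fun t => follow d l (t - dist c d)) ?_ ((ih d).comp (continuous_sub_right _))
      continuous_id continuous_const ?_
    · exact AffineMap.lineMap_continuous.comp (continuous_id.div_const _)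
    · rintro t rfl
      rw [lineMap_div_dist, sub_self, follow_zero]

theorem duration_nonneg (c : ι → ℝ) (l : List (ι → ℝ)) : 0 ≤ duration c l := by
  induction l generalizing c with
  | nil => exact le_rfl
  | cons d l ih => exact add_nonneg dist_nonneg (ih d)

theorem lineMap_mem_uIcc {c d : ι → ℝ} {t : ℝ} (ht : t ∈ Icc 0 (dist c d)) (k : ι) :
    AffineMap.lineMap c d (t / dist c d) k ∈ uIcc (c k) (d k) := by
  rw [← segment_eq_uIcc, segment_eq_image_lineMap]
  refine ⟨t / dist c d, ⟨div_nonneg ht.1 dist_nonneg, div_le_one_of_le₀ ht.2 dist_nonneg⟩, ?_⟩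
  simp [AffineMap.lineMap_apply]

theorem follow_mem {c : ι → ℝ} {l : List (ι → ℝ)} (hc : ∀ k, c k ∈ Icc (s k).lo (s k).hi)
    (hl : ∀ d ∈ l, ∀ k, d k ∈ Icc (s k).lo (s k).hi) {t : ℝ} (ht : 0 ≤ t) (k : ι) :
    follow c l t k ∈ Icc (s k).lo (s k).hi := by
  induction l generalizing c t with
  | nil => exact hc k
  | cons d l ih =>
    have hd := hl d List.mem_cons_self
    rcases le_total t (dist c d) with h | h
    · rw [follow_of_le h]
      exact ordConnected_Icc.uIcc_subset (hc k) (hd k) (lineMap_mem_uIcc ⟨ht, h⟩ k)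
    · rw [follow_of_ge h]
      exact ih hd (fun e he => hl e (List.mem_cons_of_mem _ he)) (sub_nonneg.2 h)

theorem Run.isMotion (hs : ∀ k, (s k).carrier ⊆ P.region) {x : State ι} {l : List (State ι)}
    (h : Run P s x l) (hx : StateInv P s x) :
    IsMotion s (duration x.pos (l.map State.pos)) (follow x.pos (l.map State.pos)) :=
  ⟨duration_nonneg _ _, fun i => ((continuous_apply i).comp (continuous_follow _ _)).continuousOn,
    fun _ ht k => follow_mem hx.1 (h.pos_mem hs hx) ht.1 k⟩

theorem Run.exists_seen (hs : ∀ k, (s k).carrier ⊆ P.region) {x : State ι} {l : List (State ι)}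
    (h : Run P s x l) (hx : StateInv P s x) {γ : ℝ → Pt}
    (hγ : ContinuousOn γ (Icc 0 (duration x.pos (l.map State.pos))))
    (hγP : MapsTo γ (Icc 0 (duration x.pos (l.map State.pos))) P.region)
    (h₀ : γ 0 ∈ contaminated x.tasks) :
    ∃ t ∈ Icc 0 (duration x.pos (l.map State.pos)), ∃ i ∈ robotsUsed (x :: l),
      γ t ∈ sight P (s i) (follow x.pos (l.map State.pos) t i) := by
  induction h generalizing γ with
  | done pos => exact absurd h₀ (by simp [contaminated])
  | step x y l hxy _ ih =>
    have hy := hxy.inv hs hx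
    rw [List.map_cons, duration] at *
    set D := dist x.pos y.pos
    have hD : 0 ≤ D := dist_nonneg
    have hl := duration_nonneg y.pos (l.map State.pos)
    by_contra hcon
    push Not at hcon
    have hsub : Icc 0 D ⊆ Icc 0 (D + duration y.pos (l.map State.pos)) :=
      Icc_subset_Icc_right (by linarith)
    have hstep : γ D ∈ contaminated y.tasks := by
      refine hxy.mem_contaminated hs hx hD
        (m := fun t => AffineMap.lineMap x.pos y.pos (t / D)) (fun k => ?_) (by simp)
        (lineMap_div_dist _ _) (fun t ht k => lineMap_mem_uIcc ht k) (hγ.mono hsub)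
        (hγP.mono_left hsub) (fun t ht τ hτ => ?_) h₀
      · exact ((continuous_apply k).comp (AffineMap.lineMap_continuous.comp
          (continuous_id.div_const _))).continuousOn
      · have := hcon t (hsub ht) τ.robot ⟨x, List.mem_cons_self, τ, hτ, rfl⟩
        rwa [follow_of_le ht.2] at this
    have hmaps : MapsTo (fun t => t + D) (Icc 0 (duration y.pos (l.map State.pos)))
        (Icc 0 (D + duration y.pos (l.map State.pos))) := fun t ht =>
      ⟨by linarith [ht.1], by linarith [ht.2]⟩
    obtain ⟨t, ht, i, ⟨z, hz, τ, hτ, rfl⟩, hit⟩ := ih hy (γ := fun t => γ (t + D))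
      (hγ.comp (by fun_prop) hmaps) (fun t ht => hγP (hmaps ht)) (by simpa using hstep)
    refine hcon (t + D) (hmaps ht) τ.robot ⟨z, List.mem_cons_of_mem _ hz, τ, hτ, rfl⟩ ?_
    rwa [follow_of_ge (by linarith [ht.1]), add_sub_cancel_right]

/-- The robots used by a run clear the polygon. -/
theorem Run.clears (hs : ∀ k, (s k).carrier ⊆ P.region) {i : ι} {x : State ι}
    {l : List (State ι)} (h : Run P s x l) (hx : IsStart P s i x) :
    Clears P s (robotsUsed (x :: l)) (duration x.pos (l.map State.pos))
      (follow x.pos (l.map State.pos)) := by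
  intro γ hγ hγP
  refine h.exists_seen hs (start_inv hx) hγ hγP ?_
  obtain ⟨-, d, -, ht⟩ := hx
  rw [ht]
  exact .inl (hγP (left_mem_Icc.2 (duration_nonneg _ _)))

end Runs

/-! ### Clearing and guarding -/

/-- An evader that never moves must be seen, so the segments of a clearing team guard `P`;
coinciding segments only reduce their number. -/
theorem IsMinimumGuardSet.card_le_of_clearableBy {P : OrthogonalPolygon}
    {S : Finset SlidingSegment} (hS : IsMinimumGuardSet P S) {m : ℕ} (h : ClearableBy P m) :
    S.card ≤ m := by
  classical
  obtain ⟨s, hs, T, r, ⟨hT, -, hr⟩, hclear⟩ := h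
  refine (hS.2 (Finset.univ.image s) ⟨by simpa using hs, ?_⟩).trans
    (Finset.card_image_le.trans (by simp))
  refine Subset.antisymm (iUnion₂_subset fun s _ p hp => seen_subset (mem_visibility.1 hp).1)
    fun p hp => ?_
  obtain ⟨t, ht, i, -, hi⟩ := hclear (fun _ => p) continuousOn_const fun _ _ => hp
  exact mem_iUnion₂.2 ⟨s i, by simp, sight_subset_visibility (hr t ht i) hi⟩

theorem clearableBy_ncard {P : OrthogonalPolygon} {ι : Type} [Finite ι] {s : ι → SlidingSegment}
    (hs : ∀ k, (s k).carrier ⊆ P.region) {T : ℝ} {r : ℝ → ι → ℝ} (hm : IsMotion s T r)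
    {U : Set ι} (hU : Clears P s U T r) : ClearableBy P U.ncard := by
  let e : Fin U.ncard ≃ U := (Finite.equivFinOfCardEq (Nat.card_coe_set_eq U)).symm
  refine ⟨fun k => s (e k), fun k => hs _, T, fun t k => r t (e k),
    ⟨hm.1, fun k => hm.2.1 _, fun t ht k => hm.2.2 t ht _⟩, fun γ hγ hγP => ?_⟩
  obtain ⟨t, ht, i, hi, hit⟩ := hU γ hγ hγP
  refine ⟨t, ht, e.symm ⟨i, hi⟩, trivial, ?_⟩
  simpa using hit

/-! ### Deadlock-freeness and termination -/

section Progress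

variable {ι : Type} {P : OrthogonalPolygon} {s : ι → SlidingSegment}

theorem not_ahead_self (d : Bool) (a : ℝ) : ¬ Ahead d a a := by
  cases d <;> simp [Ahead]

theorem finite_setOf_isEvent (pos : ι → ℝ) (τ : Task ι) (rest : List (Task ι)) :
    {u | IsEvent P s pos τ rest u}.Finite := by
  have h₁ : (range fun j => (s τ.robot).along (P.vertex j)).Finite := finite_range _
  have h₂ : ((fun σ : Task ι => (s τ.robot).along ((s σ.robot).point (pos σ.robot))) ''
      {σ | σ ∈ rest}).Finite := (List.finite_toSet rest).image _
  refine ((h₁.union h₂).union (finite_singleton ((s τ.robot).last τ.direction))).subset ?_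
  rintro u (⟨j, -, hj⟩ | ⟨σ, hσ, h⟩ | h)
  · exact .inl (.inl ⟨j, (mem_sight.1 hj).2⟩)
  · exact .inl (.inr ⟨σ, hσ, (mem_sight.1 h).2⟩)
  · exact .inr h

/-- Event points are finite in number and include the endpoint ahead; minimising the signed
coordinate picks the nearest in the direction of travel. -/
theorem exists_isNextEvent {pos : ι → ℝ} {τ : Task ι} {rest : List (Task ι)}
    (hpos : pos τ.robot ∈ Icc (s τ.robot).lo (s τ.robot).hi)
    (h : Ahead τ.direction (pos τ.robot) ((s τ.robot).last τ.direction)) :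
    ∃ u, IsNextEvent P s pos τ rest u := by
  set σ : ℝ := if τ.direction then 1 else -1 with hσ
  set E : Set ℝ := {u | IsEvent P s pos τ rest u ∧ u ∈ Icc (s τ.robot).lo (s τ.robot).hi ∧
    Ahead τ.direction (pos τ.robot) u}
  have hlast : (s τ.robot).last τ.direction ∈ Icc (s τ.robot).lo (s τ.robot).hi := by
    have := (s τ.robot).lo_lt_hi.le
    cases τ.direction
    · exact left_mem_Icc.2 this
    · exact right_mem_Icc.2 this
  obtain ⟨u, ⟨hu₁, hu₂, hu₃⟩, hmin⟩ := exists_min_image E (fun u => σ * u)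
    ((finite_setOf_isEvent pos τ rest).subset fun _ h => h.1) ⟨_, .inr (.inr rfl), hlast, h⟩
  refine ⟨u, hu₂, hu₃, hu₁, fun v hv₁ hv₂ hv => ?_⟩
  have hvI : v ∈ Icc (s τ.robot).lo (s τ.robot).hi := by
    generalize τ.direction = d at hv₁ hv₂
    cases d <;> simp only [Ahead] at hv₁ hv₂
    · exact ⟨hu₂.1.trans hv₂.le, hv₁.le.trans hpos.2⟩
    · exact ⟨hpos.1.trans hv₁.le, hv₂.le.trans hu₂.2⟩
  have := hmin v ⟨hv, hvI, hv₁⟩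
  rw [ahead_iff, ← hσ] at hv₂
  nlinarith

/-- The algorithm does not get stuck. -/
theorem StateInv.exists_step (hguard : ∀ p ∈ P.region, ∃ k, p ∈ visibility P (s k)) {x : State ι}
    (hx : StateInv P s x) (ht : x.tasks ≠ []) : ∃ z, Step P s x z := by
  obtain ⟨pos, tasks⟩ := x
  obtain ⟨hpos, hstack⟩ := hx
  cases tasks with
  | nil => exact absurd rfl ht
  | cons τ rest =>
  obtain ⟨hτ, hrest⟩ := hstack
  by_cases hcl : τ.todo ⊆ sight P (s τ.robot) (pos τ.robot)
  · cases rest with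
    | nil => exact ⟨_, .terminate pos τ _ hcl (hpos _) (not_ahead_self _ _)⟩
    | cons σ rest => exact ⟨_, .finish pos τ σ rest _ hcl (hpos _) (not_ahead_self _ _)⟩
  by_cases hp : ∃ W, IsPiece τ.todo (sight P (s τ.robot) (pos τ.robot)) W ∧
      Disjoint W (visibility P (s τ.robot))
  · obtain ⟨W, hW, hWd⟩ := hp
    have hWt := (isPiece_subset hW).trans sdiff_subset
    have hWr := hWt.trans hτ.todo_subset
    obtain ⟨p, hpA, rfl⟩ := hW
    have hpW := mem_connectedComponentIn hpA
    obtain ⟨k, hk⟩ := hguard p (hτ.region_subset (hWr hpW))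
    refine ⟨_, .signal pos τ rest _ k true (s k).lo ⟨p, hpA, rfl⟩ hWd ?_ ⟨p, hpW, hk⟩
      (left_mem_Icc.2 (s k).lo_lt_hi.le) fun u hu hu' => absurd hu.1 (not_le.2 hu')⟩
    -- The guard of `p` is not on the stack: `W` is unseen by `τ` and lies in its region, which is
    -- unseen by all waiting robots.
    rintro σ hσ rfl
    rcases List.mem_cons.1 hσ with rfl | hσ
    · exact disjoint_left.1 hWd hpW hk
    · exact disjoint_left.1 (hτ.unseen σ hσ) (hWr hpW) hk
  · push Not at hp
    obtain ⟨p, hpA, hps⟩ := not_subset.1 hcl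
    -- Some visible point is left, neither on the current line of sight nor behind it, so the robot
    -- has not reached its last endpoint.
    obtain ⟨y, hyW, hyv⟩ := not_disjoint_iff.1 (hp _ ⟨p, ⟨hpA, hps⟩, rfl⟩)
    obtain ⟨hyA, hys⟩ := connectedComponentIn_subset _ _ hyW
    obtain ⟨hyS, hyI⟩ := mem_visibility.1 hyv
    have hne : (s τ.robot).along y ≠ pos τ.robot := fun h => hys (mem_sight.2 ⟨hyS, h⟩)
    have hnb : ¬ Ahead τ.direction ((s τ.robot).along y) (pos τ.robot) := fun h =>
      disjoint_left.1 (hτ.behind _ hyI h) hyA (mem_sight.2 ⟨hyS, rfl⟩)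
    obtain ⟨u, hu⟩ := exists_isNextEvent (P := P) (rest := rest) (hpos τ.robot) (by
      generalize τ.direction = d at hnb
      cases d <;> simp only [Ahead, SlidingSegment.last] at hnb ⊢
      · exact hyI.1.trans_lt (lt_of_le_of_ne (not_lt.1 hnb) hne)
      · exact (lt_of_le_of_ne (not_lt.1 hnb) hne.symm).trans_le hyI.2)
    exact ⟨_, .advance pos τ rest u ⟨p, hpA, hps⟩ hp hu⟩

theorem StackInv.nodup {pos : ι → ℝ} {l : List (Task ι)} (h : StackInv P s pos l) :
    (l.map Task.robot).Nodup := by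
  induction l with
  | nil => simp
  | cons τ l ih =>
    rw [List.map_cons, List.nodup_cons]
    refine ⟨fun hmem => ?_, ih h.2⟩
    obtain ⟨σ, hσ, hστ⟩ := List.mem_map.1 hmem
    exact h.1.fresh σ hσ hστ

/-- Removing a piece leaves the other pieces as they are. -/
theorem isPiece_of_isPiece_diff {A ℓ W W' : Set Pt} (hW : IsPiece A ℓ W)
    (hW' : IsPiece (A \ W) ℓ W') : IsPiece A ℓ W' ∧ W' ≠ W := by
  obtain ⟨p, hp, rfl⟩ := hW
  obtain ⟨q, hq, rfl⟩ := hW'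
  have hqA : q ∈ A \ ℓ := ⟨hq.1.1, hq.2⟩
  refine ⟨⟨q, hqA, ?_⟩, fun h => ?_⟩
  · refine Subset.antisymm (connectedComponentIn_mono q (sdiff_subset_sdiff_left sdiff_subset)) ?_
    refine isPreconnected_connectedComponentIn.subset_connectedComponentIn
      (mem_connectedComponentIn hqA) fun r hr => ?_
    have hrA := connectedComponentIn_subset _ _ hr
    refine ⟨⟨hrA.1, fun hrp => hq.1.2 ?_⟩, hrA.2⟩
    rw [connectedComponentIn_eq hrp, ← connectedComponentIn_eq hr]
    exact mem_connectedComponentIn hqA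
  · exact hq.1.2 (h ▸ mem_connectedComponentIn hq)

theorem finite_pieces {A : Set Pt} (hA : Tame A) (u : ℝ) (s : SlidingSegment) :
    {W | IsPiece A (sight P s u) W}.Finite :=
  (hA.diff (tame_sight u)).finite_components

/-- The descent is lexicographic: `n` controls the free robots, `e` the event points ahead, `c` the
pieces. A signal uses up a free robot; when the called robot finishes, its caller resumes with the
same position and events but one piece fewer. An advance consumes an event point. Assuming
accessibility after `finish` isolates a task from the stack below it. -/
theorem StateInv.acc_of_acc_finish [Fintype ι] (hs : ∀ k, (s k).carrier ⊆ P.region) (n : ℕ) :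
    ∀ (rest : List (Task ι)) (e c : ℕ) (pos : ι → ℝ) (τ : Task ι),
    StateInv P s ⟨pos, τ :: rest⟩ → Fintype.card ι < n + (τ :: rest).length →
    {u | IsEvent P s pos τ rest u ∧ Ahead τ.direction (pos τ.robot) u}.ncard < e →
    {W | IsPiece τ.todo (sight P (s τ.robot) (pos τ.robot)) W}.ncard < c →
    (∀ pos' σ rest', rest = σ :: rest' →
      StateInv P s ⟨pos', { σ with todo := σ.todo \ τ.region } :: rest'⟩ →
      (∀ ρ ∈ rest, pos' ρ.robot = pos ρ.robot) →
      Acc (fun y x => Step P s x y) ⟨pos', { σ with todo := σ.todo \ τ.region } :: rest'⟩) →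
    Acc (fun y x => Step P s x y) ⟨pos, τ :: rest⟩ := by
  induction n with
  | zero =>
    intro rest e c pos τ hx hn
    -- Robots on the stack are distinct, so the stack cannot be longer than the number of robots.
    have := hx.2.nodup.length_le_card
    rw [List.length_map] at this
    simp only at this
    omega
  | succ n ihn =>
  intro rest e
  induction e with
  | zero => exact fun _ _ _ _ _ h => absurd h (Nat.not_lt_zero _)
  | succ e ihe =>
  intro c
  induction c with
  | zero => exact fun _ _ _ _ _ h => absurd h (Nat.not_lt_zero _)
  | succ c ihc =>
  intro pos τ hx hn he hc hfin
  refine Acc.intro _ fun y hy => ?_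
  have hinv := hy.inv hs hx
  have hτ := hx.2.1
  cases hy with
  | signal _ _ _ W j d a piece unseen free sees mem before =>
    refine ihn _ _ _ _ _ hinv (by simp only [List.length_cons] at hn ⊢; omega)
      (Nat.lt_succ_self _) (Nat.lt_succ_self _) ?_
    rintro pos' σ rest' heq hinv' hpos'
    obtain ⟨rfl, rfl⟩ := List.cons.inj heq
    have hp : ∀ ρ ∈ τ :: rest, pos' ρ.robot = pos ρ.robot := fun ρ hρ =>
      (hpos' ρ hρ).trans (place_of_ne (free ρ hρ))
    have hpτ := hp τ List.mem_cons_self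
    refine ihc pos' _ hinv' hn ?_ ?_ ?_
    · refine lt_of_eq_of_lt (congrArg ncard ?_) he
      ext u
      simp only [mem_ofPred_eq, hpτ, IsEvent]
      refine and_congr_left fun _ => or_congr_right (or_congr_left ?_)
      exact exists_congr fun σ => and_congr_right fun hσ => by
        rw [hp σ (List.mem_cons_of_mem _ hσ)]
    · refine lt_of_lt_of_le ?_ (Nat.lt_succ_iff.1 hc)
      simp only [hpτ]
      refine ncard_lt_ncard ⟨fun W' hW' => (isPiece_of_isPiece_diff piece hW').1, fun h => ?_⟩
        (finite_pieces hτ.tame_todo _ _)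
      exact (isPiece_of_isPiece_diff piece (h piece)).2 rfl
    · intro pos'' σ rest' heq hinv'' hpos''
      exact hfin pos'' σ rest' heq hinv'' fun ρ hρ =>
        (hpos'' ρ hρ).trans (hp ρ (List.mem_cons_of_mem _ hρ))
  | advance _ _ _ u left noPiece next =>
    refine ihe _ _ _ hinv hn ?_ (Nat.lt_succ_self _) ?_
    · refine lt_of_lt_of_le ?_ (Nat.lt_succ_iff.1 he)
      simp only [place_self]
      have hev : ∀ v, IsEvent P s (place pos τ.robot u) { τ with
          todo := τ.todo \ ⋃ v ∈ uIcc (pos τ.robot) u, sight P (s τ.robot) v } rest v ↔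
          IsEvent P s pos τ rest v := by
        intro v
        simp only [IsEvent]
        refine or_congr_right (or_congr_left ?_)
        exact exists_congr fun σ => and_congr_right fun hσ => by
          rw [place_of_ne (hτ.fresh σ hσ)]
      refine ncard_lt_ncard ⟨fun v hv => ⟨(hev v).1 hv.1, ?_⟩, fun h => ?_⟩
        ((finite_setOf_isEvent pos τ rest).subset fun _ h => h.1)
      · have h₁ := hv.2
        have h₂ := next.2.1
        rw [ahead_iff] at h₁ h₂ ⊢
        linarith
      · exact not_ahead_self _ _ (h ⟨next.2.2.1, next.2.1⟩).2
    · intro pos' σ rest' heq hinv' hpos'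
      exact hfin pos' σ rest' heq hinv' fun ρ hρ =>
        (hpos' ρ hρ).trans (place_of_ne (hτ.fresh ρ hρ))
  | finish _ _ σ rest' b cleared mem back =>
    exact hfin _ σ rest' rfl hinv fun ρ hρ => place_of_ne (hτ.fresh ρ hρ)
  | terminate _ _ b cleared mem back => exact Acc.intro _ fun z hz => by cases hz

/-- The algorithm terminates. -/
theorem IsStart.acc [Fintype ι] (hs : ∀ k, (s k).carrier ⊆ P.region) {i : ι} {x : State ι}
    (hx : IsStart P s i x) : Acc (fun y x => Step P s x y) x := by
  have hinv := start_inv hx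
  obtain ⟨pos, tasks⟩ := x
  obtain ⟨-, d, -, ht⟩ := hx
  simp only at ht
  subst ht
  exact hinv.acc_of_acc_finish hs _ _ _ _ _ _ (lt_of_lt_of_le (Nat.lt_succ_self _) le_rfl)
    (Nat.lt_succ_self _) (Nat.lt_succ_self _) fun _ _ _ h => by cases h

end Progress
end SlidingRobots

theorem mainTheorem4 (P : OrthogonalPolygon) (S : Finset SlidingSegment)
    (hS : IsMinimumGuardSet P S)
    (i : {s : SlidingSegment // s ∈ S}) (x : State {s : SlidingSegment // s ∈ S})
    (hx : IsStart P (fun k : {s : SlidingSegment // s ∈ S} => k.1) i x) :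
    -- deadlock-freeness: the algorithm can always continue until it terminates
    (∀ y, Relation.ReflTransGen (Step P (fun k => k.1)) x y → y.tasks ≠ [] →
      ∃ z, Step P (fun k => k.1) y z) ∧
    -- there is no infinite execution
    (¬ ∃ f : ℕ → State {s : SlidingSegment // s ∈ S},
      f 0 = x ∧ ∀ m, Step P (fun k => k.1) (f m) (f (m + 1))) ∧
    -- every execution clears the polygon with the robots that it uses, and their number is the
    -- least number of sliding robots that can clear the polygon
    (∀ l, Run P (fun k => k.1) x l →
      IsMotion (fun k => k.1) (duration x.pos (l.map State.pos))
        (follow x.pos (l.map State.pos)) ∧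
      Clears P (fun k => k.1) (robotsUsed (x :: l)) (duration x.pos (l.map State.pos))
        (follow x.pos (l.map State.pos)) ∧
      IsLeast {m | ClearableBy P m} (robotsUsed (x :: l)).ncard) := by
  have hs : ∀ k : {s : SlidingSegment // s ∈ S}, k.1.carrier ⊆ P.region := fun k => hS.1.1 k.1 k.2
  have hguard : ∀ p ∈ P.region, ∃ k : {s : SlidingSegment // s ∈ S}, p ∈ visibility P k.1 := by
    intro p hp
    rw [← hS.1.2] at hp
    obtain ⟨s, hsS, hps⟩ := mem_iUnion₂.1 hp
    exact ⟨⟨s, hsS⟩, hps⟩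
  refine ⟨fun y hy hne => ?_, ?_, fun l hl => ?_⟩
  · have hinv : StateInv P (fun k : {s : SlidingSegment // s ∈ S} => k.1) y := by
      clear hne
      induction hy with
      | refl => exact start_inv hx
      | tail _ hbc ih => exact hbc.inv hs ih
    exact hinv.exists_step hguard hne
  · rintro ⟨f, hf₀, hf⟩
    exact (acc_iff_isEmpty_descending_chain.1 (hx.acc hs)).false ⟨f, hf₀, hf⟩
  · have hm := hl.isMotion hs (start_inv hx)
    have hc := hl.clears hs hx
    refine ⟨hm, hc, clearableBy_ncard hs hm hc, fun m hm => ?_⟩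
    -- At most all of `S` is called, and every clearing team has at least `S.card` members.
    refine le_trans ?_ (hS.card_le_of_clearableBy hm)
    have := ncard_le_card (robotsUsed (x :: l))
    simpa using this
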